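/- **Setting.** Let $\mathscr W=(\mu_{a,b})_{a,b\ge 0}$ be a measure matrix of finite order $\mathcal N$: the $\mu_{a,b}$ are signed Borel measures on $\mathbb R$ with finite moments of all orders, and $\mu_{a,b}=0$ if $a>\mathcal N$ or $b>\mathcal N$. Let $\Omega$ be the union of the (closed) supports of the $\mu_{a,b}$. Put $$(f,g;\mathscr W)=\sum_{a,b=0}^{\mathcal N}\int f^{(a)}g^{(b)}\,d\mu_{a,b},\qquad G_{\mathscr W}=\big((x^i,x^j;\mathscr W)\big)_{i,j\ge 0}.$$ For a matrix $M$ write $M^{[k]}$ for its leading $k\times k$ block. A semi-infinite matrix $G$ is called LU-factorizable if $\det G^{[k]}\neq 0$ for all $k$; then $G=S_1^{-1}H(S_2^{-1})^{\top}$ with $S_1,S_2$ lower triangular with unit diagonal and $H=\operatorname{diag}(h_0,h_1,\dots)$. Assume that $G_{\mathscr W}$ is LU-factorizable, let $\chi(x)=(1,x,x^2,\dots)^\top$, and define the monic polynomials $P_{\alpha,k}=(S_\alpha\chi)_k$ $(\alpha=1,2)$, the second kind functions (for $y\notin\Omega$) $$C_{1,k}(y)=\Big(P_{1,k}(x),\tfrac1{y-x};\mathscr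 W\Big),\qquad C_{2,k}(y)=\Big(\tfrac1{y-x},P_{2,k}(x);\mathscr W\Big),$$ and the kernels $K^{[k]}(x,y)=\sum_{m<k}P_{2,m}(x)h_m^{-1}P_{1,m}(y)$, $\mathcal K_1^{[k]}(x,y)=\sum_{m<k}C_{2,m}(x)h_m^{-1}P_{1,m}(y)$, $\mathcal K_2^{[k]}(x,y)=\sum_{m<k}P_{2,m}(x)h_m^{-1}C_{1,m}(y)$. Let $Q(x)=\prod_{i=1}^s(x-q_i)^{n_i}=\sum_{m=0}^{N}Q_mx^m$ with $s\ge1$, $n_i\ge 1$, $N=\sum_i n_i$, $Q_N=1$, and distinct real $q_i\notin\Omega$. For each $i$ let $\mathring\xi^{(i)}=(\xi^{(i)}_{a,b})_{0\le a,b<n_i}$ be an arbitrary real matrix and $\xi^{(i)}$ the matrix with entries $\xi^{(i)}_{a,b}/(a!\,b!)$ for $a,b<n_i$ and $0$ otherwise. Let $\mathcal X$ be the upper triangular matrix with $x$ on the diagonal and $1,2,3,\dots$ on the first superdiagonal. The Geronimus–Sobolev transformed measure matrices are $$\check{\mathscr W}_L=[Q(\mathcal X)]^{-1}\mathscr W+\sum_{i=1}^s\xi^{(i)}\delta_{q_i},\qquad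 \check{\mathscr W}_R=\mathscr W[Q(\mathcal X^\top)]^{-1}+\sum_{i=1}^s\xi^{(i)}\delta_{q_i}.$$ When $G_{\check{\mathscr W}_R}$ (resp. $G_{\check{\mathscr W}_L}$) is LU-factorizable, $\check P_{\alpha R,k},\check h_{R,k}$ (resp. $\check P_{\alpha L,k},\check h_{L,k}$) denote its polynomials and diagonal entries, defined as above. For $f$ smooth near the $q_i$ let $\Pi_q[f]\in\mathbb R^N$ be the row vector with entries $f^{(m)}(q_i)/m!$ ($1\le i\le s$, $0\le m<n_i$, ordered lexicographically), applied row by row to column vectors of functions. Let $\mathbf Q$ be the $N\times N$ matrix $(Q_{a+b+1})_{0\le a,b<N}$ (with $Q_m=0$ for $m>N$) and $\chi^{[N]}(x)=(1,\dots,x^{N-1})^\top$. With $Q_j(x)=Q(x)/(x-q_j)^{n_j}$, $\eta_j$ the $n_j\times n_j$ exchange matrix (ones on the antidiagonal) and $T_j$ the $n_j\times n_j$ upper triangular matrix with entries $Q_j^{(b-a)}(q_j)/(b-a)!$ for $a\le b$, let $\Xi_R,\Xi_L$ be the block diagonal $N\times N$ matrices with blocks $\mathring\xi^{(j)}\eta_jT_j$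 and $(\mathring\xi^{(j)})^\top\eta_jT_j$. For invertible $A$ put $\Theta_*\begin{pmatrix}A&b\\c&d\end{pmatrix}=d-cA^{-1}b$. Finally set $$B^R_m=\Pi_q[C_{1,m}]-\Pi_q[P_{1,m}]\Xi_R,\qquad B^L_m=\Pi_q[C_{2,m}]-\Pi_q[P_{2,m}]\Xi_L,$$ let $A^R_k,A^L_k$ ($k\ge N$) be the $N\times N$ matrices with rows $B^R_{k-N},\dots,B^R_{k-1}$ and $B^L_{k-N},\dots,B^L_{k-1}$, let $$\mathring\Pi_R=A^R_N\big(\mathbf Q\,\Pi_q[\chi^{[N]}]\big)^{-1},\qquad \mathring\Pi_L=A^L_N\big(\mathbf Q\,\Pi_q[\chi^{[N]}]\big)^{-1},$$ and let $e_0=(1,0,\dots,0)^\top\in\mathbb R^N$. **Claim.** $\mathbf Q\,\Pi_q[\chi^{[N]}]$ is invertible, and all entries of $\check{\mathscr W}_R$ and $\check{\mathscr W}_L$ have finite moments of all orders. (R) Suppose that $G_{\check{\mathscr W}_R}$ is LU-factorizable. For every $k\ge N$ the matrix $A^R_k$ is invertible and, for all $x\in\mathbb R$, $$\check P_{1R,k}(x)=\Theta_*\begin{pmatrix}A^R_k&(P_{1,m}(x))_{m=k-N}^{k-1}\\B^R_k&P_{1,k}(x)\end{pmatrix},\qquad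 \check h_{R,k}=h_{k-N}\,\Theta_*\begin{pmatrix}A^R_k&e_0\\B^R_k&0\end{pmatrix},$$ $$\check P_{2R,k}(x)=-h_{k-N}\,\Theta_*\begin{pmatrix}A^R_k&e_0\\Q(x)\big(\Pi_q[\mathcal K_2^{[k]}(x,\cdot)]-\Pi_q[K^{[k]}(x,\cdot)]\Xi_R\big)+\chi^{[N]}(x)^\top\mathbf Q\,\Pi_q[\chi^{[N]}]&0\end{pmatrix}.$$ For every $k<N$ the matrix $\mathring\Pi_R^{[k]}$ is invertible and, for all $x\in\mathbb R$, $$\check P_{1R,k}(x)=\Theta_*\begin{pmatrix}\mathring\Pi_R^{[k]}&(P_{1,m}(x))_{m<k}\\((\mathring\Pi_R)_{k,m})_{m<k}&P_{1,k}(x)\end{pmatrix},\qquad \check P_{2R,k}(x)=\Theta_*\begin{pmatrix}(\mathring\Pi_R^\top)^{[k]}&(x^m)_{m<k}\\((\mathring\Pi_R^\top)_{k,m})_{m<k}&x^k\end{pmatrix},$$ $$\check h_{R,k}=-\Theta_*\begin{pmatrix}\mathring\Pi_R^{[k]}&((\mathring\Pi_R)_{m,k})_{m<k}\\((\mathring\Pi_R)_{k,m})_{m<k}&(\mathring\Pi_R)_{k,k}\end{pmatrix}.$$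 (L) Suppose that $G_{\check{\mathscr W}_L}$ is LU-factorizable. For every $k\ge N$ the matrix $A^L_k$ is invertible and, for all $x\in\mathbb R$, $$\check P_{2L,k}(x)=\Theta_*\begin{pmatrix}A^L_k&(P_{2,m}(x))_{m=k-N}^{k-1}\\B^L_k&P_{2,k}(x)\end{pmatrix},\qquad \check h_{L,k}=h_{k-N}\,\Theta_*\begin{pmatrix}A^L_k&e_0\\B^L_k&0\end{pmatrix},$$ $$\check P_{1L,k}(x)=-h_{k-N}\,\Theta_*\begin{pmatrix}A^L_k&e_0\\Q(x)\big(\Pi_q[\mathcal K_1^{[k]}(\cdot,x)]-\Pi_q[K^{[k]}(\cdot,x)]\Xi_L\big)+\chi^{[N]}(x)^\top\mathbf Q\,\Pi_q[\chi^{[N]}]&0\end{pmatrix}.$$ For every $k<N$ the matrix $\mathring\Pi_L^{[k]}$ is invertible and, for all $x\in\mathbb R$, $$\check P_{2L,k}(x)=\Theta_*\begin{pmatrix}\mathring\Pi_L^{[k]}&(P_{2,m}(x))_{m<k}\\((\mathring\Pi_L)_{k,m})_{m<k}&P_{2,k}(x)\end{pmatrix},\qquad \check P_{1L,k}(x)=\Theta_*\begin{pmatrix}(\mathring\Pi_L^\top)^{[k]}&(x^m)_{m<k}\\((\mathring\Pi_L^\top)_{k,m})_{m<k}&x^k\end{pmatrix},$$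 $$\check h_{L,k}=-\Theta_*\begin{pmatrix}\mathring\Pi_L^{[k]}&((\mathring\Pi_L)_{m,k})_{m<k}\\((\mathring\Pi_L)_{k,m})_{m<k}&(\mathring\Pi_L)_{k,k}\end{pmatrix}.$$ -/

import Mathlib

open MeasureTheory Polynomial Matrix

noncomputable section

/-! ### Moment matrices, LU factorization, monic bi-orthogonal polynomials -/

/-- The truncation `M^{[k]}`: the leading `k × k` block of a semi-infinite matrix. -/
def trunc (k : ℕ) (M : Matrix ℕ ℕ ℝ) : Matrix (Fin k) (Fin k) ℝ :=
  Matrix.of fun i j => M i j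

/-- A semi-infinite matrix admits an LU factorization iff all its leading principal minors
are non-zero. -/
def LUFactorizable (G : Matrix ℕ ℕ ℝ) : Prop :=
  ∀ k : ℕ, (trunc k G).det ≠ 0

/-- Lower triangular with ones on the main diagonal. -/
def IsLowerUnitriangular (S : Matrix ℕ ℕ ℝ) : Prop :=
  (∀ i j, i < j → S i j = 0) ∧ ∀ i, S i i = 1

/-- `G = S₁⁻¹ H (S₂⁻¹)ᵀ` with `S₁, S₂` lower unitriangular and `H = diag (h₀, h₁, …)`.  As the
inverse of a lower triangular matrix is compatible with truncation, the factorization of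
semi-infinite matrices is the factorization of all truncations. -/
structure IsLU (G S₁ S₂ : Matrix ℕ ℕ ℝ) (h : ℕ → ℝ) : Prop where
  lower₁ : IsLowerUnitriangular S₁
  lower₂ : IsLowerUnitriangular S₂
  factor : ∀ k : ℕ, trunc k G =
    (trunc k S₁)⁻¹ * Matrix.diagonal (fun i : Fin k => h i) * ((trunc k S₂)⁻¹)ᵀ

/-- A unitriangular left factor of `G`, obtained by elimination. -/
theorem LUFactorizable.exists_lower {G : Matrix ℕ ℕ ℝ} (hG : LUFactorizable G) :
    ∃ S : Matrix ℕ ℕ ℝ, IsLowerUnitriangular S ∧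
      ∀ k j, j < k → ∑ i ∈ Finset.range (k + 1), S k i * G i j = 0 := by
  refine ⟨Matrix.of fun k i => if hi : i < k then
    -((fun j : Fin k => G k j) ᵥ* (trunc k G)⁻¹) ⟨i, hi⟩ else if i = k then 1 else 0,
    ⟨fun i j hij => ?_, fun i => by simp⟩, fun k j hj => ?_⟩
  · simp [hij.not_gt, hij.ne']
  · rw [Finset.sum_range_succ, Finset.sum_range]
    simp only [Matrix.of_apply, Fin.is_lt, dite_true, Fin.eta, lt_irrefl, dite_false, if_true]
    have h1 : ((fun j : Fin k => G k j) ᵥ* (trunc k G)⁻¹) ᵥ* trunc k G =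
        fun j : Fin k => G k j := by
      rw [Matrix.vecMul_vecMul, Matrix.nonsing_inv_mul _ (isUnit_iff_ne_zero.mpr (hG k)),
        Matrix.vecMul_one]
    have h2 := congrFun h1 ⟨j, hj⟩
    simp only [Matrix.vecMul, dotProduct, trunc, Matrix.of_apply] at h2
    simp only [Matrix.vecMul, dotProduct, trunc, neg_mul, Finset.sum_neg_distrib, one_mul]
    linarith

/-- Every LU factorizable matrix has an LU factorization. -/
theorem LUFactorizable.exists_isLU {G : Matrix ℕ ℕ ℝ} (hG : LUFactorizable G) :
    ∃ (S₁ S₂ : Matrix ℕ ℕ ℝ) (h : ℕ → ℝ), IsLU G S₁ S₂ h := by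
  have hGT : LUFactorizable Gᵀ := fun k => by
    have : trunc k Gᵀ = (trunc k G)ᵀ := rfl
    rw [this, Matrix.det_transpose]
    exact hG k
  obtain ⟨S₁, h₁, e₁⟩ := hG.exists_lower
  obtain ⟨S₂, h₂, e₂⟩ := hGT.exists_lower
  refine ⟨S₁, S₂, fun k => ∑ i ∈ Finset.range (k + 1), S₁ k i * G i k, h₁, h₂, fun k => ?_⟩
  have ext0 : ∀ {S : Matrix ℕ ℕ ℝ}, IsLowerUnitriangular S → ∀ (i : Fin k) (f : ℕ → ℝ),
      ∑ j : Fin k, S i j * f j = ∑ j ∈ Finset.range ((i : ℕ) + 1), S i j * f j := by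
    intro S hS i f
    rw [← Finset.sum_range (fun j => S i j * f j)]
    symm
    refine Finset.sum_subset (fun j hj => ?_) fun j _ hj => ?_
    · simp only [Finset.mem_range] at *
      omega
    · simp only [Finset.mem_range, not_lt] at hj
      rw [hS.1 _ _ (by omega), zero_mul]
  have det1 : ∀ {S : Matrix ℕ ℕ ℝ}, IsLowerUnitriangular S → IsUnit (trunc k S).det := by
    intro S hS
    rw [Matrix.det_of_isLowerTriangular (trunc k S) (fun i j hij => hS.1 _ _ hij)]
    simp [trunc, hS.2]
  have u₁ : ∀ i j : Fin k, j < i → (trunc k S₁ * trunc k G) i j = 0 := fun i j hij => by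
    simp only [Matrix.mul_apply, trunc, Matrix.of_apply]
    rw [ext0 h₁ i (fun m => G m j), e₁ _ _ hij]
  have u₂ : ∀ i j : Fin k, i < j → (trunc k G * (trunc k S₂)ᵀ) i j = 0 := fun i j hij => by
    simp only [Matrix.mul_apply, trunc, Matrix.of_apply, Matrix.transpose_apply]
    simp_rw [mul_comm (G _ _)]
    rw [ext0 h₂ j (fun m => G i m)]
    exact e₂ _ _ hij
  have key : trunc k S₁ * trunc k G * (trunc k S₂)ᵀ =
      Matrix.diagonal (fun i : Fin k => ∑ m ∈ Finset.range ((i : ℕ) + 1), S₁ i m * G m i) := by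
    ext i j
    rcases lt_trichotomy i j with hij | rfl | hij
    · rw [Matrix.diagonal_apply_ne _ hij.ne, Matrix.mul_assoc, Matrix.mul_apply]
      refine Finset.sum_eq_zero fun m _ => ?_
      by_cases hm : m < j
      · rw [u₂ _ _ hm, mul_zero]
      · rw [show trunc k S₁ i m = 0 from h₁.1 _ _ (by simp only [Fin.lt_def] at *; omega),
          zero_mul]
    · rw [Matrix.diagonal_apply_eq, Matrix.mul_apply, Finset.sum_eq_single i]
      · rw [show (trunc k S₂)ᵀ i i = 1 from h₂.2 _, mul_one, Matrix.mul_apply]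
        exact ext0 h₁ i (fun m => G m i)
      · intro m _ hm
        rcases lt_or_gt_of_ne hm with hm | hm
        · rw [u₁ _ _ hm, zero_mul]
        · rw [show (trunc k S₂)ᵀ m i = 0 from h₂.1 _ _ hm, mul_zero]
      · simp
    · rw [Matrix.diagonal_apply_ne _ hij.ne', Matrix.mul_apply]
      refine Finset.sum_eq_zero fun m _ => ?_
      by_cases hm : m < i
      · rw [u₁ _ _ hm, zero_mul]
      · rw [show (trunc k S₂)ᵀ m j = 0 from h₂.1 _ _ (by simp only [Fin.lt_def] at *; omega),
          mul_zero]
  rw [← key, Matrix.transpose_nonsing_inv, Matrix.mul_assoc, Matrix.mul_assoc,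
    Matrix.mul_nonsing_inv _ (by rw [Matrix.det_transpose]; exact det1 h₂), Matrix.mul_one,
    ← Matrix.mul_assoc, Matrix.nonsing_inv_mul _ (det1 h₁), Matrix.one_mul]

/-- The monic polynomial `P_k = (S χ)_k = ∑_{i ≤ k} S_{k,i} x^i`. -/
def monicPoly (S : Matrix ℕ ℕ ℝ) (k : ℕ) : ℝ[X] :=
  ∑ i ∈ Finset.range (k + 1), C (S k i) * X ^ i

/-- The last quasi-determinant (Schur complement) `d - c A⁻¹ b` of the bordered matrix
with blocks `A | b` and `c | d`. -/
def quasiDet {k : ℕ} (A : Matrix (Fin k) (Fin k) ℝ) (b c : Fin k → ℝ) (d : ℝ) : ℝ :=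
  d - c ⬝ᵥ (A⁻¹ *ᵥ b)

/-! ### Measure matrices and Sobolev bilinear functions -/

/-- A measure matrix of finite order: a semi-infinite matrix of (signed) Borel measures on `ℝ`
whose entries vanish as soon as one of the indices exceeds the order. -/
structure MeasureMatrix where
  order : ℕ
  entry : ℕ → ℕ → SignedMeasure ℝ
  entry_eq_zero : ∀ a b, order < a ∨ order < b → entry a b = 0

namespace MeasureMatrix

/-- All entries have finite moments of all orders, so that every integral in `(x^i, x^j; W)`
exists. -/
def HasFiniteMoments (W : MeasureMatrix) : Prop :=
  ∀ a b k : ℕ, (W.entry a b).Integrable (fun x : ℝ => x ^ k)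

/-- `Ω`, the union of the supports of the entries. -/
def Omega (W : MeasureMatrix) : Set ℝ :=
  ⋃ (a : ℕ) (b : ℕ), (W.entry a b).variation.support

/-- The Sobolev bilinear function `(f, g; W) = ∑_{a,b} ∫ f^{(a)} g^{(b)} dμ_{a,b}`. -/
def form (W : MeasureMatrix) (f g : ℝ → ℝ) : ℝ :=
  ∑ a ∈ Finset.range (W.order + 1), ∑ b ∈ Finset.range (W.order + 1),
    (W.entry a b).integral (fun x => iteratedDeriv a f x * iteratedDeriv b g x)
      (ContinuousLinearMap.lsmul ℝ ℝ)

/-- The Sobolev moment matrix `G_{i,j} = (x^i, x^j; W)`. -/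
def moment (W : MeasureMatrix) : Matrix ℕ ℕ ℝ :=
  Matrix.of fun i j => W.form (fun x => x ^ i) (fun x => x ^ j)

/-- Second kind functions `C_{1,l}(y) = (P_{1,l}(x), 1/(y-x); W)`. -/
def secondKind₁ (W : MeasureMatrix) (S₁ : Matrix ℕ ℕ ℝ) (l : ℕ) (y : ℝ) : ℝ :=
  W.form (fun x => (monicPoly S₁ l).eval x) (fun x => 1 / (y - x))

/-- Second kind functions `C_{2,l}(y) = (1/(y-x), P_{2,l}(x); W)`. -/
def secondKind₂ (W : MeasureMatrix) (S₂ : Matrix ℕ ℕ ℝ) (l : ℕ) (y : ℝ) : ℝ :=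
  W.form (fun x => 1 / (y - x)) (fun x => (monicPoly S₂ l).eval x)

end MeasureMatrix

/-- Christoffel–Darboux kernel `K^{[l]}(x,y) = ∑_{k<l} P_{2,k}(x) h_k⁻¹ P_{1,k}(y)`. -/
def cdKernel (S₁ S₂ : Matrix ℕ ℕ ℝ) (h : ℕ → ℝ) (l : ℕ) (x y : ℝ) : ℝ :=
  ∑ k ∈ Finset.range l, (monicPoly S₂ k).eval x * (h k)⁻¹ * (monicPoly S₁ k).eval y

/-- First mixed kernel `𝒦₁^{[l]}(x,y) = ∑_{k<l} C_{2,k}(x) h_k⁻¹ P_{1,k}(y)`. -/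
def mixedKernel₁ (W : MeasureMatrix) (S₁ S₂ : Matrix ℕ ℕ ℝ) (h : ℕ → ℝ) (l : ℕ) (x y : ℝ) : ℝ :=
  ∑ k ∈ Finset.range l, W.secondKind₂ S₂ k x * (h k)⁻¹ * (monicPoly S₁ k).eval y

/-- Second mixed kernel `𝒦₂^{[l]}(x,y) = ∑_{k<l} P_{2,k}(x) h_k⁻¹ C_{1,k}(y)`. -/
def mixedKernel₂ (W : MeasureMatrix) (S₁ S₂ : Matrix ℕ ℕ ℝ) (h : ℕ → ℝ) (l : ℕ) (x y : ℝ) : ℝ :=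
  ∑ k ∈ Finset.range l, (monicPoly S₂ k).eval x * (h k)⁻¹ * W.secondKind₁ S₁ k y

/-! ### Geronimus–Sobolev transformations -/

/-- The operator `𝒳` of multiplication by `x`, truncated to the size `(K+1) × (K+1)`:
`x` on the diagonal and `1, 2, 3, …` on the first superdiagonal.  As `𝒳` is upper triangular,
polynomials in `𝒳` and their inverses are compatible with this truncation. -/
def mulX (K : ℕ) (x : ℝ) : Matrix (Fin (K + 1)) (Fin (K + 1)) ℝ :=
  Matrix.of fun i j => if i = j then x else if (i : ℕ) + 1 = j then (j : ℝ) else 0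

/-- Data of a Geronimus–Sobolev transformation: nodes `q_i` with multiplicities `n_i`, and for
each node an `n_i × n_i` matrix of free parameters `ξ^{(i)}_{a,b}`. -/
structure GeronimusData where
  s : ℕ
  q : Fin s → ℝ
  n : Fin s → ℕ
  ξ : ∀ i : Fin s, Matrix (Fin (n i)) (Fin (n i)) ℝ

namespace GeronimusData

variable (Γ : GeronimusData)

/-- `N = ∑ n_i`, the degree of `Q`. -/
def N : ℕ := ∑ i, Γ.n i

/-- `Q(x) = ∏ (x - q_i)^{n_i}`. -/
def Q : ℝ[X] := ∏ i, (X - C (Γ.q i)) ^ Γ.n i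

/-- `Q_j(x) = Q(x) / (x - q_j)^{n_j}`. -/
def Qdiv (j : Fin Γ.s) : ℝ[X] := ∏ i ∈ Finset.univ.erase j, (X - C (Γ.q i)) ^ Γ.n i

/-- The `N × N` block of the matrix `𝐐`, with entries `Q_{a+b+1}`. -/
def Qmat : Matrix (Fin Γ.N) (Fin Γ.N) ℝ := Matrix.of fun a b => Γ.Q.coeff (a + b + 1)

/-- Numbering of the pairs (node, order of derivative) by `0, …, N-1`, in lexicographic order. -/
def idx : ((i : Fin Γ.s) × Fin (Γ.n i)) ≃ Fin Γ.N := finSigmaFinEquiv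

/-- The vector of germs `Π_q[f]`: its entries are `f^{(m)}(q_i) / m!`, `0 ≤ m < n_i`. -/
def germ (f : ℝ → ℝ) : Fin Γ.N → ℝ := fun c =>
  iteratedDeriv ((Γ.idx.symm c).2 : ℕ) f (Γ.q (Γ.idx.symm c).1) /
    (((Γ.idx.symm c).2 : ℕ).factorial : ℝ)

/-- The `N × N` matrix `Π_q[χ^{[N]}]`, whose rows are the germs of `1, x, …, x^{N-1}`. -/
def germChi : Matrix (Fin Γ.N) (Fin Γ.N) ℝ := Matrix.of fun a => Γ.germ fun x => x ^ (a : ℕ)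

/-- The exchange matrix `η`. -/
def eta (k : ℕ) : Matrix (Fin k) (Fin k) ℝ :=
  Matrix.of fun a b => if (a : ℕ) + b + 1 = k then 1 else 0

/-- The upper triangular Toeplitz matrix with entries `Q_j^{(b-a)}(q_j) / (b-a)!`, `a ≤ b`. -/
def taylorQ (j : Fin Γ.s) : Matrix (Fin (Γ.n j)) (Fin (Γ.n j)) ℝ :=
  Matrix.of fun a b => if (a : ℕ) ≤ b then
    (Polynomial.derivative^[(b : ℕ) - a] (Γ.Qdiv j)).eval (Γ.q j) /
      ((((b : ℕ) - a).factorial : ℕ) : ℝ) else 0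

/-- `Ξ_R`, block diagonal with blocks `ξ^{(j)} η (Toeplitz matrix of Q_j)`. -/
def XiR : Matrix (Fin Γ.N) (Fin Γ.N) ℝ :=
  (Matrix.blockDiagonal' fun j => Γ.ξ j * eta (Γ.n j) * Γ.taylorQ j).submatrix
    Γ.idx.symm Γ.idx.symm

/-- `Ξ_L`, block diagonal with blocks `(ξ^{(j)})ᵀ η (Toeplitz matrix of Q_j)`. -/
def XiL : Matrix (Fin Γ.N) (Fin Γ.N) ℝ :=
  (Matrix.blockDiagonal' fun j => (Γ.ξ j)ᵀ * eta (Γ.n j) * Γ.taylorQ j).submatrix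
    Γ.idx.symm Γ.idx.symm

/-- The entry `(a, b)` of the discrete part `∑_i ξ^{(i)} δ(x - q_i)`, where the entries of the
matrix at `q_i` are `ξ^{(i)}_{a,b} / (a! b!)` for `a, b < n_i` and zero otherwise. -/
def massEntry (a b : ℕ) : SignedMeasure ℝ :=
  ∑ i, if hab : a < Γ.n i ∧ b < Γ.n i then
    VectorMeasure.dirac (Γ.q i) (Γ.ξ i ⟨a, hab.1⟩ ⟨b, hab.2⟩ / ((a.factorial : ℝ) * b.factorial))
  else 0

theorem massEntry_eq_zero {a b : ℕ} (h : Finset.univ.sup Γ.n < a ∨ Finset.univ.sup Γ.n < b) :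
    Γ.massEntry a b = 0 := by
  unfold massEntry
  refine Finset.sum_eq_zero fun i _ => dif_neg fun hab => ?_
  have := Finset.le_sup (f := Γ.n) (Finset.mem_univ i)
  omega

/-- The row vector `Π_q[c] - Π_q[p] Ξ`. -/
def germDiff (Ξ : Matrix (Fin Γ.N) (Fin Γ.N) ℝ) (c p : ℝ → ℝ) : Fin Γ.N → ℝ :=
  Γ.germ c - Γ.germ p ᵥ* Ξ

end GeronimusData

namespace MeasureMatrix

/-- The left transformed measure matrix `[Q(𝒳)]⁻¹ W + ∑_i ξ^{(i)} δ(x - q_i)`. -/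
def geronimusL (W : MeasureMatrix) (Γ : GeronimusData) : MeasureMatrix where
  order := max W.order (Finset.univ.sup Γ.n)
  entry a b :=
    (if ha : a < W.order + 1 then
      ∑ m : Fin (W.order + 1), (W.entry m b).withDensity
        (fun x => (aeval (mulX W.order x) Γ.Q)⁻¹ ⟨a, ha⟩ m) (ContinuousLinearMap.lsmul ℝ ℝ)
    else 0) + Γ.massEntry a b
  entry_eq_zero a b h := by
    rw [Γ.massEntry_eq_zero (by omega), add_zero]
    split_ifs with ha
    · refine Finset.sum_eq_zero fun m _ => ?_
      rw [W.entry_eq_zero m b (Or.inr (by omega)), VectorMeasure.withDensity_zero_vectorMeasure]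
    · rfl

/-- The right transformed measure matrix `W [Q(𝒳ᵀ)]⁻¹ + ∑_i ξ^{(i)} δ(x - q_i)`. -/
def geronimusR (W : MeasureMatrix) (Γ : GeronimusData) : MeasureMatrix where
  order := max W.order (Finset.univ.sup Γ.n)
  entry a b :=
    (if hb : b < W.order + 1 then
      ∑ m : Fin (W.order + 1), (W.entry a m).withDensity
        (fun x => (aeval (mulX W.order x)ᵀ Γ.Q)⁻¹ m ⟨b, hb⟩) (ContinuousLinearMap.lsmul ℝ ℝ)
    else 0) + Γ.massEntry a b
  entry_eq_zero a b h := by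
    rw [Γ.massEntry_eq_zero (by omega), add_zero]
    split_ifs with hb
    · refine Finset.sum_eq_zero fun m _ => ?_
      rw [W.entry_eq_zero a m (Or.inl (by omega)), VectorMeasure.withDensity_zero_vectorMeasure]
    · rfl

/-- The row `Π_q[C_{1,m}] - Π_q[P_{1,m}] Ξ_R`. -/
def rowR (W : MeasureMatrix) (Γ : GeronimusData) (S₁ : Matrix ℕ ℕ ℝ) (m : ℕ) : Fin Γ.N → ℝ :=
  Γ.germDiff Γ.XiR (W.secondKind₁ S₁ m) (fun x => (monicPoly S₁ m).eval x)

/-- The row `Π_q[C_{2,m}] - Π_q[P_{2,m}] Ξ_L`. -/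
def rowL (W : MeasureMatrix) (Γ : GeronimusData) (S₂ : Matrix ℕ ℕ ℝ) (m : ℕ) : Fin Γ.N → ℝ :=
  Γ.germDiff Γ.XiL (W.secondKind₂ S₂ m) (fun x => (monicPoly S₂ m).eval x)

/-- The `N × N` matrix with rows `Π_q[C_{1,m}] - Π_q[P_{1,m}] Ξ_R`, `m = m₀, …, m₀ + N - 1`. -/
def blockR (W : MeasureMatrix) (Γ : GeronimusData) (S₁ : Matrix ℕ ℕ ℝ) (m₀ : ℕ) :
    Matrix (Fin Γ.N) (Fin Γ.N) ℝ :=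
  Matrix.of fun a => W.rowR Γ S₁ (m₀ + a)

/-- The `N × N` matrix with rows `Π_q[C_{2,m}] - Π_q[P_{2,m}] Ξ_L`, `m = m₀, …, m₀ + N - 1`. -/
def blockL (W : MeasureMatrix) (Γ : GeronimusData) (S₂ : Matrix ℕ ℕ ℝ) (m₀ : ℕ) :
    Matrix (Fin Γ.N) (Fin Γ.N) ℝ :=
  Matrix.of fun a => W.rowL Γ S₂ (m₀ + a)

/-- `Q(x) (Π_q[𝒦₂^{[k]}(x,·)] - Π_q[K^{[k]}(x,·)] Ξ_R) + χ^{[N]}(x)ᵀ 𝐐 Π_q[χ^{[N]}]`. -/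
def kernelRowR (W : MeasureMatrix) (Γ : GeronimusData) (S₁ S₂ : Matrix ℕ ℕ ℝ) (h : ℕ → ℝ)
    (k : ℕ) (x : ℝ) : Fin Γ.N → ℝ :=
  Γ.Q.eval x • Γ.germDiff Γ.XiR (fun y => mixedKernel₂ W S₁ S₂ h k x y)
      (fun y => cdKernel S₁ S₂ h k x y)
    + (fun a : Fin Γ.N => x ^ (a : ℕ)) ᵥ* (Γ.Qmat * Γ.germChi)

/-- `Q(x) (Π_q[𝒦₁^{[k]}(·,x)] - Π_q[K^{[k]}(·,x)] Ξ_L) + χ^{[N]}(x)ᵀ 𝐐 Π_q[χ^{[N]}]`. -/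
def kernelRowL (W : MeasureMatrix) (Γ : GeronimusData) (S₁ S₂ : Matrix ℕ ℕ ℝ) (h : ℕ → ℝ)
    (k : ℕ) (x : ℝ) : Fin Γ.N → ℝ :=
  Γ.Q.eval x • Γ.germDiff Γ.XiL (fun y => mixedKernel₁ W S₁ S₂ h k y x)
      (fun y => cdKernel S₁ S₂ h k y x)
    + (fun a : Fin Γ.N => x ^ (a : ℕ)) ᵥ* (Γ.Qmat * Γ.germChi)

/-- The `N × N` matrix `Π̊_R`. -/
def PiR (W : MeasureMatrix) (Γ : GeronimusData) (S₁ : Matrix ℕ ℕ ℝ) :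
    Matrix (Fin Γ.N) (Fin Γ.N) ℝ :=
  W.blockR Γ S₁ 0 * (Γ.Qmat * Γ.germChi)⁻¹

/-- The `N × N` matrix `Π̊_L`. -/
def PiL (W : MeasureMatrix) (Γ : GeronimusData) (S₂ : Matrix ℕ ℕ ℝ) :
    Matrix (Fin Γ.N) (Fin Γ.N) ℝ :=
  W.blockL Γ S₂ 0 * (Γ.Qmat * Γ.germChi)⁻¹

end MeasureMatrix

/-- The leading `k × k` block of an `N × N` matrix, for `k : Fin N`. -/
def leadingBlock {N : ℕ} (M : Matrix (Fin N) (Fin N) ℝ) (k : Fin N) :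
    Matrix (Fin (k : ℕ)) (Fin (k : ℕ)) ℝ :=
  M.submatrix (Fin.castLE k.isLt.le) (Fin.castLE k.isLt.le)

/-- The last quasi-determinant of the bordered matrix built from the leading `k × k` block of
`M`, the row `M_{k,0}, …, M_{k,k-1}`, the column `b` and the corner `d`. -/
def borderedQuasiDet {N : ℕ} (M : Matrix (Fin N) (Fin N) ℝ) (k : Fin N)
    (b : Fin (k : ℕ) → ℝ) (d : ℝ) : ℝ :=
  quasiDet (leadingBlock M k) b (fun j => M k (Fin.castLE k.isLt.le j)) d

/-- The column `(1, 0, …, 0)ᵀ`. -/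
def firstUnit (N : ℕ) : Fin N → ℝ := fun a => if (a : ℕ) = 0 then 1 else 0

end

/-! ### Integration against signed measures -/

namespace SignedIntegral

variable {α : Type*} [MeasurableSpace α]

/-! Write ⟨p, g⟩ and ⟨p, g⟩_R for the bilinear forms on polynomials whose Gram matrices are the
moment matrices of W and of its right transform (`bil`). Everything rests on one computation,
`form_geronimusR`: if g = Q u near Ω with u smooth there, then ⟨p, g⟩_R = (p, u; W) + (mass terms).
Indeed multiplication by Q acts on jets as Q(𝒳ᵀ), which the density [Q(𝒳ᵀ)]⁻¹ undoes.

For g = Q f the masses vanish, since they only see Taylor coefficients at q_i of order below n_i;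
hence ⟨p, Q f⟩_R = ⟨p, f⟩. For g = Q/(x - q_i)^{m+1} one has u = (x - q_i)^{-m-1}. Differentiating
the second kind function C_p of p under the integral and computing the masses gives minus an entry
of Π_q[C_p] - Π_q[p] Ξ_R. The coefficient vectors of these quotients are the columns of D = 𝐐
Π_q[χ^{[N]}], so this whole row equals -(⟨p, x^a⟩_R)_{a<N} D (`germDiff_XiR`, abstracted as
`momentRow`). The matrix D is invertible because 𝐐 is triangular after reversing its columns and
Π_q[χ^{[N]}] is a confluent Vandermonde matrix.

What remains is linear algebra with two LU-factorizable forms satisfying ⟨p, Q f⟩_R = ⟨p, f⟩. For k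
= n + N the transformed P̌_{1,k} is R-orthogonal to Q P_{2,m} for m < n, so its expansion in the
P_{1,m} involves only m = n, …, k. The coefficients are fixed by the vanishing of its moment row,
which yields the quasi-determinant, and the coefficient at m = n is ȟ_k / h_n. For P̌_{2,k} the same
expansion is applied to the polynomial Q(x) K^{[k]}(x, ·) - Ǩ^{[k]}(x, ·) formed from the two
Christoffel–Darboux kernels: its coefficient at m = n is P̌_{2,k}(x) / h_n. For k < N the matrix
Π̊_R consists of the numbers -⟨P_{1,m}, x^a⟩_R, and the formulas are plain orthogonalization. The
left transformation is the right one for the transposed data. -/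

theorem lsmul_flip : (ContinuousLinearMap.lsmul ℝ ℝ (E := ℝ)).flip =
    ContinuousLinearMap.lsmul ℝ ℝ := by
  ext
  simp

theorem integrable_toSignedMeasure {m : Measure α} [IsFiniteMeasure m] {f : α → ℝ}
    (hf : Integrable f m) : VectorMeasure.Integrable m.toSignedMeasure f := by
  rw [VectorMeasure.Integrable, Measure.variation_toSignedMeasure]
  exact hf

theorem integral_eq_sub {ν : SignedMeasure α} {m₁ m₂ : Measure α} [IsFiniteMeasure m₁]
    [IsFiniteMeasure m₂] (hν : ν = m₁.toSignedMeasure - m₂.toSignedMeasure) {f : α → ℝ}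
    (h₁ : Integrable f m₁) (h₂ : Integrable f m₂) :
    ν.integral f (ContinuousLinearMap.lsmul ℝ ℝ) = ∫ x, f x ∂m₁ - ∫ x, f x ∂m₂ := by
  rw [hν, VectorMeasure.integral_sub_vectorMeasure (integrable_toSignedMeasure h₁)
    (integrable_toSignedMeasure h₂), ← lsmul_flip, VectorMeasure.integral_toSignedMeasure,
    VectorMeasure.integral_toSignedMeasure]

theorem integrable_of_eq_sub {ν : SignedMeasure α} {m₁ m₂ : Measure α} [IsFiniteMeasure m₁]
    [IsFiniteMeasure m₂] (hν : ν = m₁.toSignedMeasure - m₂.toSignedMeasure) {f : α → ℝ}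
    (h₁ : Integrable f m₁) (h₂ : Integrable f m₂) : ν.Integrable f := by
  rw [hν]
  exact (integrable_toSignedMeasure h₁).sub_vectorMeasure (integrable_toSignedMeasure h₂)

/-- Every signed measure is a difference of two finite measures dominated by its variation. -/
theorem exists_eq_sub (ν : SignedMeasure α) : ∃ (m₁ m₂ : Measure α) (_ : IsFiniteMeasure m₁)
    (_ : IsFiniteMeasure m₂), ν = m₁.toSignedMeasure - m₂.toSignedMeasure ∧
      m₁ ≤ ν.variation ∧ m₂ ≤ ν.variation := by
  refine ⟨ν.toJordanDecomposition.posPart, ν.toJordanDecomposition.negPart, inferInstance,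
    inferInstance, ν.toSignedMeasure_toJordanDecomposition.symm, ?_, ?_⟩
  · rw [← SignedMeasure.totalVariation_eq_variation]
    exact Measure.le_add_right le_rfl
  · rw [← SignedMeasure.totalVariation_eq_variation]
    exact Measure.le_add_left le_rfl

/-- Where ρ < 0 the density `ENNReal.ofReal (ρ x)` is 0, so integrability of f against it only
concerns the restriction of f ρ to {ρ ≥ 0}. -/
theorem integral_withDensity_ofReal {m : Measure α} {ρ f : α → ℝ}
    (hρm : Measurable ρ) (hf : Integrable (fun x => f x * ρ x) m) :
    Integrable f (m.withDensity fun x => ENNReal.ofReal (ρ x)) ∧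
      ∫ x, f x ∂(m.withDensity fun x => ENNReal.ofReal (ρ x)) = ∫ x, f x * max (ρ x) 0 ∂m := by
  have hm : Measurable fun x => (ρ x).toNNReal := hρm.real_toNNReal
  have key : Integrable f (m.withDensity fun x => ((ρ x).toNNReal : ENNReal)) := by
    rw [integrable_withDensity_iff_integrable_coe_smul hm]
    have h1 : Integrable (fun x => {x | 0 ≤ ρ x}.indicator (fun x => f x * ρ x) x) m :=
      hf.indicator (measurableSet_le measurable_const hρm)
    refine h1.congr (Filter.Eventually.of_forall fun x => ?_)
    by_cases hx : 0 ≤ ρ x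
    · simp [Set.indicator, hx, mul_comm]
    · simp [Set.indicator, hx, (not_le.mp hx).le]
  refine ⟨key, ?_⟩
  have := integral_withDensity_eq_integral_smul (μ := m) hm f
  simp only [ENNReal.ofReal] at *
  rw [this]
  refine integral_congr_ae (Filter.Eventually.of_forall fun x => ?_)
  simp [NNReal.smul_def, mul_comm]

/-- Splitting μ into positive and negative parts, and ρ likewise, reduces the claim to four positive
measures. The separate integrability of ρ makes these four measures finite. -/
theorem integral_withDensity {μ : SignedMeasure α} {ρ f : α → ℝ} (hρm : Measurable ρ)
    (hρ : μ.Integrable ρ) (hf : μ.Integrable fun x => f x * ρ x) :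
    (μ.withDensity ρ (ContinuousLinearMap.lsmul ℝ ℝ)).Integrable f ∧
    (μ.withDensity ρ (ContinuousLinearMap.lsmul ℝ ℝ)).integral f
      (ContinuousLinearMap.lsmul ℝ ℝ) =
      μ.integral (fun x => f x * ρ x) (ContinuousLinearMap.lsmul ℝ ℝ) := by
  obtain ⟨m₁, m₂, _, _, hμ, h₁, h₂⟩ := exists_eq_sub μ
  have ρ₁ : Integrable ρ m₁ := hρ.mono_measure h₁
  have ρ₂ : Integrable ρ m₂ := hρ.mono_measure h₂
  have f₁ : Integrable (fun x => f x * ρ x) m₁ := MeasureTheory.Integrable.mono_measure hf h₁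
  have f₂ : Integrable (fun x => f x * ρ x) m₂ := MeasureTheory.Integrable.mono_measure hf h₂
  have fn₁ : Integrable (fun x => f x * -ρ x) m₁ := by simpa using f₁.neg
  have fn₂ : Integrable (fun x => f x * -ρ x) m₂ := by simpa using f₂.neg
  have fin : ∀ {m : Measure α} {σ : α → ℝ}, Integrable σ m →
      IsFiniteMeasure (m.withDensity fun x => ENNReal.ofReal (σ x)) := fun hσ =>
    isFiniteMeasure_withDensity_ofReal hσ.2
  have := fin ρ₁
  have := fin ρ₂
  have i₁ : IsFiniteMeasure (m₁.withDensity fun x => ENNReal.ofReal (-ρ x)) := fin ρ₁.neg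
  have i₂ : IsFiniteMeasure (m₂.withDensity fun x => ENNReal.ofReal (-ρ x)) := fin ρ₂.neg
  -- With μ = m₁ - m₂, the terms of positive sign are m₁ρ⁺ and m₂ρ⁻, those of negative sign m₁ρ⁻ and
  -- m₂ρ⁺.
  have dec : μ.withDensity ρ (ContinuousLinearMap.lsmul ℝ ℝ) =
      ((m₁.withDensity fun x => ENNReal.ofReal (ρ x)) +
        (m₂.withDensity fun x => ENNReal.ofReal (-ρ x))).toSignedMeasure -
      ((m₁.withDensity fun x => ENNReal.ofReal (-ρ x)) +
        (m₂.withDensity fun x => ENNReal.ofReal (ρ x))).toSignedMeasure := by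
    have e : μ.withDensity ρ (ContinuousLinearMap.lsmul ℝ ℝ) =
        m₁.withDensityᵥ ρ - m₂.withDensityᵥ ρ := by
      ext s hs
      rw [VectorMeasure.withDensity_apply hρ, _root_.sub_apply,
        withDensityᵥ_apply ρ₁ hs, withDensityᵥ_apply ρ₂ hs]
      refine integral_eq_sub (m₁ := m₁.restrict s) (m₂ := m₂.restrict s) ?_
        ρ₁.restrict ρ₂.restrict
      ext t ht
      rw [hμ, VectorMeasure.restrict_apply _ hs ht]
      simp [ht, ht.inter hs, measureReal_restrict_apply]
    rw [e, withDensityᵥ_eq_withDensity_pos_part_sub_withDensity_neg_part ρ₁,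
      withDensityᵥ_eq_withDensity_pos_part_sub_withDensity_neg_part ρ₂,
      Measure.toSignedMeasure_add, Measure.toSignedMeasure_add]
    abel
  obtain ⟨a₁, b₁⟩ := integral_withDensity_ofReal hρm f₁
  obtain ⟨a₂, b₂⟩ := integral_withDensity_ofReal hρm f₂
  obtain ⟨a₃, b₃⟩ := integral_withDensity_ofReal hρm.fun_neg fn₁
  obtain ⟨a₄, b₄⟩ := integral_withDensity_ofReal hρm.fun_neg fn₂
  have hi₁ := a₁.add_measure a₄
  have hi₂ := a₃.add_measure a₂
  refine ⟨integrable_of_eq_sub dec hi₁ hi₂, ?_⟩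
  rw [integral_eq_sub dec hi₁ hi₂, integral_eq_sub hμ f₁ f₂, integral_add_measure a₁ a₄,
    integral_add_measure a₃ a₂, b₁, b₂, b₃, b₄]
  have split : ∀ {m : Measure α}, Integrable (fun x => f x * ρ x) m →
      ∫ x, f x * ρ x ∂m = ∫ x, f x * max (ρ x) 0 ∂m - ∫ x, f x * max (-ρ x) 0 ∂m := by
    intro m hm
    have hpos : Integrable (fun x => f x * max (ρ x) 0) m := by
      refine (hm.indicator (measurableSet_le (measurable_const (a := (0 : ℝ))) hρm)).congr
        (Filter.Eventually.of_forall fun x => ?_)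
      by_cases hx : 0 ≤ ρ x
      · simp [Set.indicator, hx]
      · simp [Set.indicator, hx, (not_le.mp hx).le]
    have hneg : Integrable (fun x => f x * max (-ρ x) 0) m := by
      refine (hpos.sub hm).congr (Filter.Eventually.of_forall fun x => ?_)
      rcases le_total 0 (ρ x) with hx | hx
      · simp [hx]
      · simp [hx]
    rw [← integral_sub hpos hneg]
    refine integral_congr_ae (Filter.Eventually.of_forall fun x => ?_)
    rcases le_total 0 (ρ x) with hx | hx
    · simp [hx]
    · simp [hx]
  rw [split f₁, split f₂]
  ring

theorem integral_sum_smul {ν : SignedMeasure α} {ι : Type*} (s : Finset ι) (c : ι → ℝ)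
    {f : ι → α → ℝ} (hf : ∀ i ∈ s, ν.Integrable (f i)) :
    ν.integral (fun x => ∑ i ∈ s, c i • f i x) (ContinuousLinearMap.lsmul ℝ ℝ) =
      ∑ i ∈ s, c i * ν.integral (f i) (ContinuousLinearMap.lsmul ℝ ℝ) := by
  rw [VectorMeasure.integral_finsetSum (f := fun i x => c i • f i x) s fun i hi =>
    MeasureTheory.Integrable.smul (c i) (hf i hi)]
  refine Finset.sum_congr rfl fun i _ => ?_
  rw [VectorMeasure.integral_fun_smul, smul_eq_mul]

/-- Differentiation under the integral sign. -/
theorem hasDerivAt_integral {ν : SignedMeasure α} {bound : α → ℝ} {F F' : ℝ → α → ℝ} {x₀ : ℝ}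
    {s : Set ℝ} (hs : s ∈ nhds x₀) (hF : ∀ x, Measurable (F x)) (hF' : ∀ x, Measurable (F' x))
    (hi : ∀ᶠ x in nhds x₀, ν.Integrable (F x))
    (hb : ∀ᵐ a ∂ν.variation, ∀ x ∈ s, ‖F' x a‖ ≤ bound a)
    (hbi : ν.Integrable bound)
    (hd : ∀ᵐ a ∂ν.variation, ∀ x ∈ s, HasDerivAt (fun x => F x a) (F' x a) x) :
    HasDerivAt (fun x => ν.integral (F x) (ContinuousLinearMap.lsmul ℝ ℝ))
      (ν.integral (F' x₀) (ContinuousLinearMap.lsmul ℝ ℝ)) x₀ := by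
  obtain ⟨m₁, m₂, _, _, hν, h₁, h₂⟩ := exists_eq_sub ν
  have key : ∀ {m : Measure α}, m ≤ ν.variation → Integrable (F' x₀) m ∧
      HasDerivAt (fun n => ∫ a, F n a ∂m) (∫ a, F' x₀ a ∂m) x₀ := fun {m} hm =>
    hasDerivAt_integral_of_dominated_loc_of_deriv_le hs
      (Filter.Eventually.of_forall fun x => (hF x).aestronglyMeasurable)
      (MeasureTheory.Integrable.mono_measure hi.self_of_nhds hm) (hF' x₀).aestronglyMeasurable
      (hm.absolutelyContinuous.ae_le hb) (MeasureTheory.Integrable.mono_measure hbi hm)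
      (hm.absolutelyContinuous.ae_le hd)
  obtain ⟨i₁, d₁⟩ := key h₁
  obtain ⟨i₂, d₂⟩ := key h₂
  rw [integral_eq_sub hν i₁ i₂]
  refine (d₁.sub d₂).congr_of_eventuallyEq ?_
  filter_upwards [hi] with x hx
  exact integral_eq_sub hν (MeasureTheory.Integrable.mono_measure hx h₁)
    (MeasureTheory.Integrable.mono_measure hx h₂)

end SignedIntegral

/-! ### Iterated derivatives -/

/-- A family of functions each of which is the derivative of the previous one on an open set
consists of the iterated derivatives of its first member. -/
theorem iteratedDeriv_eq_of_hasDerivAt {U : Set ℝ} (hU : IsOpen U) {F : ℕ → ℝ → ℝ}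
    (hF : ∀ n, ∀ x ∈ U, HasDerivAt (F n) (F (n + 1) x) x) (n : ℕ) {x : ℝ} (hx : x ∈ U) :
    iteratedDeriv n (F 0) x = F n x := by
  induction n generalizing x with
  | zero => simp
  | succ n ih =>
    rw [iteratedDeriv_succ]
    have : iteratedDeriv n (F 0) =ᶠ[nhds x] F n := by
      filter_upwards [hU.mem_nhds hx] with y hy using ih hy
    rw [this.deriv_eq, (hF n x hx).deriv]

theorem iteratedDeriv_polynomial_eval (p : ℝ[X]) (a : ℕ) :
    iteratedDeriv a (fun x => p.eval x) = fun x => (Polynomial.derivative^[a] p).eval x := by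
  ext x
  refine iteratedDeriv_eq_of_hasDerivAt (F := fun n x => (Polynomial.derivative^[n] p).eval x)
    isOpen_univ (fun n x _ => ?_) a (Set.mem_univ x)
  rw [Function.iterate_succ_apply']
  exact (Polynomial.derivative^[n] p).hasDerivAt x

theorem hasDerivAt_inv_pow_succ (n : ℕ) {t : ℝ} (ht : t ≠ 0) :
    HasDerivAt (fun t : ℝ => (t ^ (n + 1))⁻¹) (-(n + 1 : ℝ) * (t ^ (n + 2))⁻¹) t := by
  have h := (hasDerivAt_pow (n + 1) t).inv (pow_ne_zero _ ht)
  refine h.congr_deriv ?_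
  push_cast
  field_simp
  ring

theorem iteratedDeriv_one_div_sub (b : ℕ) {x y : ℝ} (h : x ≠ y) :
    iteratedDeriv b (fun x => 1 / (y - x)) x = (b.factorial : ℝ) * ((y - x) ^ (b + 1))⁻¹ := by
  have := iteratedDeriv_eq_of_hasDerivAt (U := {y}ᶜ)
    (F := fun n x => (n.factorial : ℝ) * ((y - x) ^ (n + 1))⁻¹) isOpen_compl_singleton
    (fun n x hx => ?_) b h
  · simpa using this
  · have h1 := (hasDerivAt_inv_pow_succ n (sub_ne_zero.mpr (Ne.symm hx))).comp x
      ((hasDerivAt_id x).const_sub y)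
    refine (h1.const_mul (n.factorial : ℝ)).congr_deriv ?_
    rw [Nat.factorial_succ]
    push_cast
    ring

theorem iteratedDeriv_inv_sub_pow (m b : ℕ) {x q : ℝ} (h : x ≠ q) :
    iteratedDeriv b (fun x => ((x - q) ^ (m + 1))⁻¹) x =
      (-1) ^ b * ((m + b).factorial / m.factorial : ℝ) * ((x - q) ^ (m + b + 1))⁻¹ := by
  have := iteratedDeriv_eq_of_hasDerivAt (U := {q}ᶜ)
    (F := fun b x => (-1) ^ b * ((m + b).factorial / m.factorial : ℝ) *
      ((x - q) ^ (m + b + 1))⁻¹) isOpen_compl_singleton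
    (fun n x hx => ?_) b h
  · simpa [Nat.factorial_ne_zero] using this
  · have h1 := (hasDerivAt_inv_pow_succ (m + n) (sub_ne_zero.mpr hx)).comp x
      ((hasDerivAt_id x).sub_const q)
    refine (h1.const_mul ((-1) ^ n * ((m + n).factorial / m.factorial : ℝ))).congr_deriv ?_
    rw [← add_assoc m n 1, Nat.factorial_succ]
    push_cast
    ring

namespace MeasureMatrix

variable {W : MeasureMatrix}

/-! ### Integrability -/

/-- Finite order makes Ω a finite union of closed supports. -/
theorem isClosed_Omega (W : MeasureMatrix) : IsClosed W.Omega := by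
  have : W.Omega = ⋃ a ∈ Finset.range (W.order + 1), ⋃ b ∈ Finset.range (W.order + 1),
      (W.entry a b).variation.support := by
    ext x
    simp only [Omega, Set.mem_iUnion, Finset.mem_range, exists_prop]
    refine ⟨fun ⟨a, b, h⟩ => ?_, fun ⟨a, _, b, _, h⟩ => ⟨a, b, h⟩⟩
    by_cases hab : W.order < a ∨ W.order < b
    · rw [W.entry_eq_zero a b hab, VectorMeasure.variation_zero] at h
      simp at h
    · exact ⟨a, by omega, b, by omega, h⟩
  rw [this]
  exact isClosed_biUnion_finset fun a _ => isClosed_biUnion_finset fun b _ =>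
    Measure.isClosed_support

/-- The complement of a support is null. Hence identities and bounds under the integrals need only
be checked on Ω, where 1/(y - x) and 1/Q have no poles. -/
theorem ae_mem_Omega (W : MeasureMatrix) (a b : ℕ) :
    ∀ᵐ x ∂(W.entry a b).variation, x ∈ W.Omega := by
  refine measure_mono_null (t := (W.entry a b).variation.supportᶜ) ?_ Measure.measure_compl_support
  intro x hx hx'
  exact hx (Set.mem_iUnion₂.mpr ⟨a, b, hx'⟩)

theorem HasFiniteMoments.integrable_eval (hW : W.HasFiniteMoments) (a b : ℕ) (p : ℝ[X]) :
    (W.entry a b).Integrable (fun x => p.eval x) := by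
  simp only [eval_eq_sum_range]
  exact integrable_finsetSum _ fun i _ => (hW a b i).const_mul _

/-- Measurable functions that are bounded on `Ω`. -/
def BoundedOmega (W : MeasureMatrix) (g : ℝ → ℝ) : Prop :=
  Measurable g ∧ ∃ c, ∀ x ∈ W.Omega, |g x| ≤ c

theorem BoundedOmega.mul {f g : ℝ → ℝ} (hf : W.BoundedOmega f) (hg : W.BoundedOmega g) :
    W.BoundedOmega (fun x => f x * g x) := by
  obtain ⟨hf, c, hc⟩ := hf
  obtain ⟨hg, d, hd⟩ := hg
  refine ⟨hf.mul hg, c * d, fun x hx => ?_⟩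
  rw [abs_mul]
  exact mul_le_mul (hc x hx) (hd x hx) (abs_nonneg _) ((abs_nonneg _).trans (hc x hx))

theorem boundedOmega_const (c : ℝ) : W.BoundedOmega (fun _ => c) :=
  ⟨measurable_const, |c|, fun _ _ => le_rfl⟩

theorem BoundedOmega.pow {f : ℝ → ℝ} (hf : W.BoundedOmega f) (n : ℕ) :
    W.BoundedOmega (fun x => f x ^ n) := by
  induction n with
  | zero => simpa using boundedOmega_const 1
  | succ n ih => simpa [pow_succ] using ih.mul hf

theorem BoundedOmega.prod {ι : Type*} (s : Finset ι) {f : ι → ℝ → ℝ}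
    (hf : ∀ i, W.BoundedOmega (f i)) : W.BoundedOmega (fun x => ∏ i ∈ s, f i x) := by
  classical
  induction s using Finset.induction_on with
  | empty => simpa using boundedOmega_const 1
  | insert i s hi ih => simpa [Finset.prod_insert hi] using (hf i).mul ih

/-- The lower bound is uniform for z near y, as the dominating function for differentiation under
the integral requires. -/
theorem exists_dist_Omega {y : ℝ} (hy : y ∉ W.Omega) : ∃ δ > 0, ∀ z, |z - y| < δ →
    ∀ x ∈ W.Omega, δ ≤ |z - x| := by
  obtain ⟨ε, hε, h⟩ := Metric.isOpen_iff.mp W.isClosed_Omega.isOpen_compl y hy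
  -- Half the radius is spent on moving from y to z, the other half is left as the distance from z
  -- to Ω.
  refine ⟨ε / 2, by positivity, fun z hz x hx => ?_⟩
  by_contra! hzx
  refine h (?_ : x ∈ Metric.ball y ε) hx
  rw [Metric.mem_ball, Real.dist_eq]
  have : |x - y| ≤ |x - z| + |z - y| := abs_sub_le x z y
  rw [abs_sub_comm x z] at this
  linarith

theorem boundedOmega_inv_sub {y : ℝ} (hy : y ∉ W.Omega) :
    W.BoundedOmega (fun x => (x - y)⁻¹) := by
  obtain ⟨δ, hδ, h⟩ := exists_dist_Omega hy
  refine ⟨(measurable_id.sub_const y).inv, δ⁻¹, fun x hx => ?_⟩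
  rw [abs_inv, abs_sub_comm]
  exact inv_anti₀ hδ (h y (by simpa using hδ) x hx)

theorem boundedOmega_inv_pow_sub {y : ℝ} (hy : y ∉ W.Omega) (n : ℕ) :
    W.BoundedOmega (fun x => ((y - x) ^ n)⁻¹) := by
  have h := ((boundedOmega_const (W := W) (-1)).mul (boundedOmega_inv_sub hy)).pow n
  have e : (fun x => ((y - x) ^ n)⁻¹) = fun x => (-1 * (x - y)⁻¹) ^ n := by
    ext x
    rw [← inv_pow, neg_one_mul, neg_inv, neg_sub]
  rwa [e]

theorem HasFiniteMoments.integrable_mul (hW : W.HasFiniteMoments) (a b : ℕ) (p : ℝ[X])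
    {g : ℝ → ℝ} (hg : W.BoundedOmega g) :
    (W.entry a b).Integrable (fun x => p.eval x * g x) := by
  obtain ⟨hm, c, hc⟩ := hg
  refine (hW.integrable_eval a b p).mul_bdd (c := c) hm.aestronglyMeasurable ?_
  filter_upwards [W.ae_mem_Omega a b] with x hx using hc x hx

/-- All products of polynomials with derivatives of `u` are integrable. -/
def Admissible (W : MeasureMatrix) (u : ℝ → ℝ) : Prop :=
  ∀ (a b c : ℕ) (p : ℝ[X]), (W.entry a b).Integrable fun x => p.eval x * iteratedDeriv c u x

theorem HasFiniteMoments.admissible_eval (hW : W.HasFiniteMoments) (p : ℝ[X]) :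
    W.Admissible (fun x => p.eval x) := by
  intro a b c r
  simp only [iteratedDeriv_polynomial_eval, ← eval_mul]
  exact hW.integrable_eval _ _ _

theorem HasFiniteMoments.admissible_of_boundedOmega (hW : W.HasFiniteMoments) {u : ℝ → ℝ}
    {g : ℕ → ℝ → ℝ} (hg : ∀ c, W.BoundedOmega (g c))
    (h : ∀ c, ∀ x ∈ W.Omega, iteratedDeriv c u x = g c x) : W.Admissible u := by
  intro a b c r
  refine (hW.integrable_mul a b r (hg c)).congr ?_
  filter_upwards [W.ae_mem_Omega a b] with x hx
  rw [h c x hx]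

theorem HasFiniteMoments.admissible_one_div (hW : W.HasFiniteMoments) {y : ℝ}
    (hy : y ∉ W.Omega) : W.Admissible (fun x => 1 / (y - x)) :=
  hW.admissible_of_boundedOmega
    (fun c => (boundedOmega_const _).mul (boundedOmega_inv_pow_sub hy (c + 1)))
    fun c _ hx => iteratedDeriv_one_div_sub c (ne_of_mem_of_not_mem hx hy)

/-! ### Linearity of the Sobolev form -/

theorem form_comm_eval (W : MeasureMatrix) (u : ℝ → ℝ) (p : ℝ[X]) :
    W.form (fun x => p.eval x) u = ∑ a ∈ Finset.range (W.order + 1),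
      ∑ b ∈ Finset.range (W.order + 1), (W.entry a b).integral
        (fun x => (Polynomial.derivative^[a] p).eval x * iteratedDeriv b u x)
        (ContinuousLinearMap.lsmul ℝ ℝ) := by
  simp only [form, iteratedDeriv_polynomial_eval]

/-- Admissibility of u supplies the integrability without which the integral is not additive. It is
applied to 1/(y - x) for y ∉ Ω, where it turns the mixed kernel into the second kind function of the
Christoffel–Darboux kernel. -/
theorem Admissible.form_sum {u : ℝ → ℝ} (hu : W.Admissible u) {ι : Type*} (s : Finset ι)
    (c : ι → ℝ) (p : ι → ℝ[X]) :
    W.form (fun x => (∑ i ∈ s, c i • p i).eval x) u =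
      ∑ i ∈ s, c i * W.form (fun x => (p i).eval x) u := by
  simp only [form_comm_eval, Finset.mul_sum]
  symm
  rw [Finset.sum_comm]
  refine Finset.sum_congr rfl fun a _ => ?_
  rw [Finset.sum_comm]
  refine Finset.sum_congr rfl fun b _ => ?_
  symm
  have e : ∀ x, (Polynomial.derivative^[a] (∑ i ∈ s, c i • p i)).eval x * iteratedDeriv b u x =
      ∑ i ∈ s, c i • ((Polynomial.derivative^[a] (p i)).eval x * iteratedDeriv b u x) := by
    intro x
    rw [Polynomial.iterate_derivative_sum, eval_finsetSum, Finset.sum_mul]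
    simp [Polynomial.iterate_derivative_smul, mul_assoc]
  simp only [e]
  exact SignedIntegral.integral_sum_smul s c fun i _ => hu a b b (Polynomial.derivative^[a] (p i))

theorem HasFiniteMoments.form_eval_right (hW : W.HasFiniteMoments) (i : ℕ) (g : ℝ[X]) :
    W.form (fun x => x ^ i) (fun x => g.eval x) =
      ∑ j ∈ Finset.range (g.natDegree + 1), g.coeff j * W.moment i j := by
  have e : ∀ x : ℝ, x ^ i = (X ^ i : ℝ[X]).eval x := by simp
  have e' : ∀ j : ℕ, (fun x : ℝ => x ^ j) = fun x => (X ^ j : ℝ[X]).eval x := by simp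
  simp only [moment, Matrix.of_apply, e', form_comm_eval, Finset.mul_sum]
  symm
  rw [Finset.sum_comm]
  refine Finset.sum_congr rfl fun a _ => ?_
  rw [Finset.sum_comm]
  refine Finset.sum_congr rfl fun b _ => ?_
  symm
  have e : ∀ x, (Polynomial.derivative^[a] (X ^ i : ℝ[X])).eval x *
      iteratedDeriv b (fun x => g.eval x) x = ∑ j ∈ Finset.range (g.natDegree + 1), g.coeff j •
      ((Polynomial.derivative^[a] (X ^ i : ℝ[X])).eval x *
        iteratedDeriv b (fun x => (X ^ j : ℝ[X]).eval x) x) := by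
    intro x
    simp only [iteratedDeriv_polynomial_eval]
    conv_lhs => rw [g.as_sum_range_C_mul_X_pow]
    rw [Polynomial.iterate_derivative_sum, eval_finsetSum, Finset.mul_sum]
    refine Finset.sum_congr rfl fun j _ => ?_
    rw [Polynomial.iterate_derivative_C_mul, eval_C_mul, smul_eq_mul]
    ring
  simp only [e]
  exact SignedIntegral.integral_sum_smul _ _ fun j _ => hW.admissible_eval (X ^ j) a b b _

/-! ### Derivatives of the second kind functions -/

/-- On a ball around y whose points stay at distance δ from Ω, the derivative of the integrand is
dominated by a multiple of |p|, which is integrable. -/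
theorem HasFiniteMoments.hasDerivAt_cauchy (hW : W.HasFiniteMoments) (a b n : ℕ) (p : ℝ[X])
    {y : ℝ} (hy : y ∉ W.Omega) :
    HasDerivAt (fun y => (W.entry a b).integral (fun x => p.eval x * ((y - x) ^ (n + 1))⁻¹)
        (ContinuousLinearMap.lsmul ℝ ℝ))
      ((W.entry a b).integral (fun x => p.eval x * (-(n + 1 : ℝ) * ((y - x) ^ (n + 2))⁻¹))
        (ContinuousLinearMap.lsmul ℝ ℝ)) y := by
  obtain ⟨δ, hδ, h⟩ := exists_dist_Omega hy
  have hp : Measurable fun x => p.eval x := p.continuous.measurable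
  refine SignedIntegral.hasDerivAt_integral (s := Metric.ball y δ)
    (F := fun y x => p.eval x * ((y - x) ^ (n + 1))⁻¹)
    (F' := fun y x => p.eval x * (-(n + 1 : ℝ) * ((y - x) ^ (n + 2))⁻¹))
    (bound := fun x => |p.eval x| * ((n + 1) * (δ ^ (n + 2))⁻¹))
    (Metric.ball_mem_nhds y hδ) (fun y => by fun_prop) (fun y => by fun_prop) ?_ ?_ ?_ ?_
  · filter_upwards [W.isClosed_Omega.isOpen_compl.mem_nhds hy] with z hz
    exact hW.integrable_mul a b p (boundedOmega_inv_pow_sub hz _)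
  · filter_upwards [W.ae_mem_Omega a b] with x hx z hz
    rw [Real.norm_eq_abs, abs_mul, abs_mul, abs_neg, abs_inv, abs_pow,
      abs_of_nonneg (by positivity : (0 : ℝ) ≤ n + 1)]
    have := h z hz x hx
    gcongr
  · exact (hW.integrable_eval a b p).abs.mul_const _
  · filter_upwards [W.ae_mem_Omega a b] with x hx z hz
    have hzx : z - x ≠ 0 := fun h0 => by
      have := h z hz x hx
      rw [h0, abs_zero] at this
      linarith
    have h1 := (hasDerivAt_inv_pow_succ n hzx).comp z ((hasDerivAt_id z).sub_const x)
    refine (h1.const_mul (p.eval x)).congr_deriv ?_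
    ring

/-- The m-th derivative of 1/(y - x) in y is (-1)^m m! (y - x)^{-m-1} = -m! (x - y)^{-m-1}, and it
may be taken inside the Sobolev form. This identifies the germs of second kind functions with
pairings against poles at q. -/
theorem HasFiniteMoments.iteratedDeriv_form_one_div (hW : W.HasFiniteMoments) (p : ℝ[X]) (m : ℕ)
    {q : ℝ} (hq : q ∉ W.Omega) :
    iteratedDeriv m (fun y => W.form (fun x => p.eval x) (fun x => 1 / (y - x))) q =
      -(m.factorial * W.form (fun x => p.eval x) (fun x => ((x - q) ^ (m + 1))⁻¹)) := by
  have hU := W.isClosed_Omega.isOpen_compl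
  -- The explicit candidate for the m-th derivative: b derivatives in x and m in y of 1/(y - x) give
  -- (-1)^m (b + m)! (y - x)^{-(b+m+1)}.
  set F : ℕ → ℝ → ℝ := fun m y => ∑ a ∈ Finset.range (W.order + 1),
    ∑ b ∈ Finset.range (W.order + 1), ((-1) ^ m * ((b + m).factorial : ℝ)) *
      (W.entry a b).integral
        (fun x => (Polynomial.derivative^[a] p).eval x * ((y - x) ^ (b + m + 1))⁻¹)
        (ContinuousLinearMap.lsmul ℝ ℝ) with hF
  have hF0 : ∀ y ∈ W.Omegaᶜ, W.form (fun x => p.eval x) (fun x => 1 / (y - x)) = F 0 y := by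
    intro y hy
    rw [form_comm_eval, hF]
    refine Finset.sum_congr rfl fun a _ => Finset.sum_congr rfl fun b _ => ?_
    rw [← smul_eq_mul (_ * _) (VectorMeasure.integral _ _ _), ← VectorMeasure.integral_fun_smul]
    refine VectorMeasure.integral_congr_ae ?_
    filter_upwards [W.ae_mem_Omega a b] with x hx
    rw [iteratedDeriv_one_div_sub b (ne_of_mem_of_not_mem hx hy)]
    simp
    ring
  have hFd : ∀ n, ∀ y ∈ W.Omegaᶜ, HasDerivAt (F n) (F (n + 1) y) y := by
    intro n y hy
    refine HasDerivAt.fun_sum fun a _ => HasDerivAt.fun_sum fun b _ => ?_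
    refine ((hW.hasDerivAt_cauchy a b (b + n) (Polynomial.derivative^[a] p) hy).const_mul
      ((-1) ^ n * ((b + n).factorial : ℝ))).congr_deriv ?_
    rw [← smul_eq_mul _ (VectorMeasure.integral _ _ _), ← VectorMeasure.integral_fun_smul,
      ← smul_eq_mul _ (VectorMeasure.integral _ _ _), ← VectorMeasure.integral_fun_smul]
    congr 1
    ext x
    rw [← add_assoc b n 1, Nat.factorial_succ]
    simp only [smul_eq_mul]
    push_cast
    ring
  have hev : (fun y => W.form (fun x => p.eval x) (fun x => 1 / (y - x))) =ᶠ[nhds q] F 0 := by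
    filter_upwards [hU.mem_nhds hq] with y hy using hF0 y hy
  rw [hev.iteratedDeriv_eq, iteratedDeriv_eq_of_hasDerivAt hU hFd m hq, form_comm_eval, hF,
    Finset.mul_sum, ← Finset.sum_neg_distrib]
  refine Finset.sum_congr rfl fun a _ => ?_
  rw [Finset.mul_sum, ← Finset.sum_neg_distrib]
  refine Finset.sum_congr rfl fun b _ => ?_
  rw [← neg_mul, ← smul_eq_mul _ (VectorMeasure.integral _ _ _),
    ← VectorMeasure.integral_fun_smul, ← smul_eq_mul _ (VectorMeasure.integral _ _ _),
    ← VectorMeasure.integral_fun_smul]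
  refine VectorMeasure.integral_congr_ae ?_
  filter_upwards [W.ae_mem_Omega a b] with x hx
  have hxq : x ≠ q := ne_of_mem_of_not_mem hx hq
  rw [iteratedDeriv_inv_sub_pow m b hxq, ← neg_sub x q, neg_pow (x - q), add_comm b m]
  have h0 : x - q ≠ 0 := sub_ne_zero.mpr hxq
  simp only [smul_eq_mul, mul_inv, ← inv_pow, inv_neg, inv_one]
  -- The factor (-1)^m comes from the derivatives in y and (-1)^(m+b+1) from replacing y - x by x -
  -- y; the sign (-1)^b is that of the derivatives of the pole in x.
  have h1 : ((-1 : ℝ)) ^ m * (-1) ^ (m + b + 1) = -(-1) ^ b := by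
    rw [← pow_add, show m + (m + b + 1) = 2 * m + b + 1 by ring, pow_succ, pow_add, pow_mul]
    simp
  have hm : (m.factorial : ℝ) ≠ 0 := by positivity
  field_simp
  linear_combination (derivative^[a] p).eval x * h1

end MeasureMatrix

/-! ### Invertibility through left kernels, and polynomials with prescribed coefficient vectors -/

theorem isUnit_det_of_vecMul_eq_zero {k : ℕ} {M : Matrix (Fin k) (Fin k) ℝ}
    (h : ∀ v, v ᵥ* M = 0 → v = 0) : IsUnit M.det := by
  rw [isUnit_iff_ne_zero]
  intro h0
  obtain ⟨v, hv, hv0⟩ := Matrix.exists_vecMul_eq_zero_iff.mpr h0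
  exact hv (h v hv0)

theorem coeff_sum_smul_X_pow {k : ℕ} (v : Fin k → ℝ) (a : Fin k) :
    (∑ b, v b • (X : ℝ[X]) ^ (b : ℕ)).coeff a = v a := by
  rw [finsetSum_coeff, Finset.sum_eq_single a]
  · simp
  · intro b _ hb
    simp [coeff_X_pow, Fin.val_inj, hb.symm]
  · simp

theorem degree_sum_smul_X_pow_lt {k : ℕ} (v : Fin k → ℝ) :
    (∑ b, v b • (X : ℝ[X]) ^ (b : ℕ)).degree < k := by
  refine (degree_sum_le _ _).trans_lt ((Finset.sup_lt_iff (WithBot.bot_lt_coe k)).mpr ?_)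
  intro b _
  refine (degree_smul_le _ _).trans_lt ?_
  rw [degree_X_pow]
  exact Nat.cast_lt.mpr b.isLt

namespace GeronimusData

variable (Γ : GeronimusData)

/-! ### Germs of polynomials and the polynomial `Q` -/

theorem germ_eval (p : ℝ[X]) (c : Fin Γ.N) : Γ.germ (fun x => p.eval x) c =
    (taylor (Γ.q (Γ.idx.symm c).1) p).coeff ((Γ.idx.symm c).2 : ℕ) := by
  rw [germ, iteratedDeriv_polynomial_eval, taylor_coeff, ← factorial_smul_hasseDeriv]
  simp only [LinearMap.smul_apply, eval_smul]
  rw [nsmul_eq_mul, mul_div_cancel_left₀]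
  positivity

theorem Q_monic : Γ.Q.Monic := monic_prod_of_monic _ _ fun _ _ => (monic_X_sub_C _).pow _

theorem Q_natDegree : Γ.Q.natDegree = Γ.N := by
  rw [Q, natDegree_prod_of_monic _ _ fun _ _ => (monic_X_sub_C _).pow _]
  simp [N]

theorem Q_coeff_N : Γ.Q.coeff Γ.N = 1 := by
  rw [← Γ.Q_natDegree]
  exact Γ.Q_monic

theorem Q_eq_mul_Qdiv (i : Fin Γ.s) : Γ.Q = (X - C (Γ.q i)) ^ Γ.n i * Γ.Qdiv i := by
  rw [Q, Qdiv, Finset.mul_prod_erase Finset.univ (fun i => (X - C (Γ.q i)) ^ Γ.n i)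
    (Finset.mem_univ i)]

theorem taylor_X_sub_C_pow (q : ℝ) (n : ℕ) : taylor q ((X - C q) ^ n) = X ^ n := by
  rw [taylor_pow]
  simp

theorem taylor_Q_coeff {i : Fin Γ.s} {m : ℕ} (hm : m < Γ.n i) (p : ℝ[X]) :
    (taylor (Γ.q i) (Γ.Q * p)).coeff m = 0 := by
  rw [Γ.Q_eq_mul_Qdiv i, mul_assoc, taylor_mul, taylor_X_sub_C_pow, coeff_X_pow_mul',
    if_neg (by omega)]

/-- `Q / (X - q_i)^{m+1}`. -/
noncomputable def quotQ (i : Fin Γ.s) (m : ℕ) : ℝ[X] :=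
  (X - C (Γ.q i)) ^ (Γ.n i - 1 - m) * Γ.Qdiv i

theorem quotQ_mul {i : Fin Γ.s} {m : ℕ} (hm : m < Γ.n i) :
    (X - C (Γ.q i)) ^ (m + 1) * Γ.quotQ i m = Γ.Q := by
  rw [quotQ, ← mul_assoc, ← pow_add, Γ.Q_eq_mul_Qdiv i]
  congr 2
  omega

theorem divX_iterate_coeff (p : ℝ[X]) (a b : ℕ) : (divX^[a] p).coeff b = p.coeff (b + a) := by
  induction a generalizing b with
  | zero => rfl
  | succ a ih => rw [Function.iterate_succ_apply', coeff_divX, ih]; congr 1; ring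

/-- Summation by parts, the engine of synthetic division by X - q. -/
theorem sum_C_mul_X_pow_mul_X_sub_C (u : ℕ → ℝ) (q : ℝ) (n : ℕ) :
    (X - C q) * ∑ a ∈ Finset.range n, C (u (a + 1)) * X ^ a =
      C (u n) * X ^ n - C (u 0) + ∑ a ∈ Finset.range n, C (u a - q * u (a + 1)) * X ^ a := by
  induction n with
  | zero => simp
  | succ n ih =>
    rw [Finset.sum_range_succ, mul_add, ih, Finset.sum_range_succ]
    simp only [C_sub, C_mul]
    ring

theorem germChi_apply (a c : Fin Γ.N) : Γ.germChi a c =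
    (taylor (Γ.q (Γ.idx.symm c).1) (X ^ (a : ℕ))).coeff ((Γ.idx.symm c).2 : ℕ) := by
  rw [← germ_eval]
  simp [germChi]

theorem Qmat_mul_germChi_apply (a c : Fin Γ.N) : (Γ.Qmat * Γ.germChi) a c =
    (taylor (Γ.q (Γ.idx.symm c).1) (divX^[a + 1] Γ.Q)).coeff ((Γ.idx.symm c).2 : ℕ) := by
  have hN : 0 < Γ.N := a.pos
  have h : divX^[a + 1] Γ.Q = ∑ b : Fin Γ.N, Γ.Qmat a b • X ^ (b : ℕ) := by
    rw [as_sum_range' (divX^[a + 1] Γ.Q) Γ.N, Finset.sum_range]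
    · refine Finset.sum_congr rfl fun b _ => ?_
      rw [divX_iterate_coeff, ← C_mul_X_pow_eq_monomial, smul_eq_C_mul, Qmat, Matrix.of_apply]
      congr 3
      ring
    · refine (Nat.le_sub_one_iff_lt hN).mp (natDegree_le_iff_coeff_eq_zero.mpr fun b hb => ?_)
      rw [divX_iterate_coeff]
      exact coeff_eq_zero_of_natDegree_lt (by rw [Γ.Q_natDegree]; omega)
  rw [Matrix.mul_apply, h, map_sum, finsetSum_coeff]
  refine Finset.sum_congr rfl fun b _ => ?_
  rw [germChi_apply, map_smul, coeff_smul, smul_eq_mul]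

/-- The E a are the Horner tails of P. Synthetic division says that their values at q are the
coefficients of the quotient of P by X - q. The recursion E_a = X E_{a+1} + P_a shows that the next
Taylor coefficients at q arise by dividing the previous quotient by X - q again, provided that P
vanishes at q to the required order. -/
theorem X_sub_C_pow_mul_sum_taylor {E : ℕ → ℝ[X]} {P : ℝ[X]} {n : ℕ} {q : ℝ}
    (hE : ∀ a, E a = E (a + 1) * X + C (P.coeff a)) (hE0 : E 0 = P) (hEn : E n = 1)
    (hP : P = ∑ a ∈ Finset.range n, C (P.coeff a) * X ^ a + X ^ n) (m : ℕ)
    (ht : ∀ k ≤ m, (taylor q P).coeff k = 0) :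
    (X - C q) ^ (m + 1) * ∑ a ∈ Finset.range n, C ((taylor q (E (a + 1))).coeff m) * X ^ a = P := by
  induction m with
  | zero =>
    have h := sum_C_mul_X_pow_mul_X_sub_C (fun a => (taylor q (E a)).coeff 0) q n
    have e : ∀ a, (taylor q (E a)).coeff 0 - q * (taylor q (E (a + 1))).coeff 0 = P.coeff a :=
      fun a => by
        rw [hE a, taylor_coeff_zero, taylor_coeff_zero]
        simp
        ring
    simp only [e, hE0, hEn, ht 0 le_rfl] at h
    rw [zero_add, pow_one, h]
    conv_rhs => rw [hP]
    simp
    ring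
  | succ m ih =>
    have h := sum_C_mul_X_pow_mul_X_sub_C (fun a => (taylor q (E a)).coeff (m + 1)) q n
    have e : ∀ a, (taylor q (E a)).coeff (m + 1) - q * (taylor q (E (a + 1))).coeff (m + 1) =
        (taylor q (E (a + 1))).coeff m := fun a => by
      rw [hE a, map_add, taylor_mul, taylor_X, taylor_C, mul_add, coeff_add, coeff_add,
        coeff_mul_X, coeff_C_succ, coeff_mul_C]
      ring
    simp only [e, hE0, hEn, ht (m + 1) le_rfl] at h
    rw [pow_succ, mul_assoc, h, taylor_one, C_1, coeff_one, if_neg m.succ_ne_zero, C_0, zero_mul,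
      sub_zero, zero_add]
    exact ih fun k hk => ht k (by omega)

theorem sum_taylor_divX (i : Fin Γ.s) {m : ℕ} (hm : m < Γ.n i) :
    ∑ a ∈ Finset.range Γ.N, C ((taylor (Γ.q i) (divX^[a + 1] Γ.Q)).coeff m) * X ^ a =
      Γ.quotQ i m := by
  have hrec : ∀ a, divX^[a] Γ.Q = divX^[a + 1] Γ.Q * X + C (Γ.Q.coeff a) := fun a => by
    rw [Function.iterate_succ_apply', ← zero_add a, ← divX_iterate_coeff, zero_add,
      divX_mul_X_add]
  have hEN : divX^[Γ.N] Γ.Q = 1 := by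
    ext b
    rw [divX_iterate_coeff, coeff_one]
    split_ifs with hb
    · rw [hb, zero_add, Γ.Q_coeff_N]
    · exact coeff_eq_zero_of_natDegree_lt (by rw [Γ.Q_natDegree]; omega)
  have hQ : Γ.Q = ∑ a ∈ Finset.range Γ.N, C (Γ.Q.coeff a) * X ^ a + X ^ Γ.N := by
    conv_lhs => rw [Γ.Q.as_sum_range_C_mul_X_pow, Γ.Q_natDegree, Finset.sum_range_succ,
      Γ.Q_coeff_N, C_1, one_mul]
  have h := X_sub_C_pow_mul_sum_taylor (E := fun a => divX^[a] Γ.Q) hrec rfl hEN hQ m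
    fun k hk => by simpa using Γ.taylor_Q_coeff (i := i) (m := k) (by omega) 1
  exact mul_left_cancel₀ (pow_ne_zero (m + 1) (X_sub_C_ne_zero (Γ.q i)))
    (h.trans (Γ.quotQ_mul hm).symm)

/-- The columns of `𝐐 Π_q[χ]` consist of the coefficients of `Q / (X - q_i)^{m+1}`. -/
theorem coeff_quotQ (a c : Fin Γ.N) : (Γ.quotQ (Γ.idx.symm c).1 (Γ.idx.symm c).2).coeff a =
    (Γ.Qmat * Γ.germChi) a c := by
  rw [Qmat_mul_germChi_apply, ← Γ.sum_taylor_divX _ (Γ.idx.symm c).2.isLt, finsetSum_coeff]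
  simp [coeff_C_mul, coeff_X_pow, a.isLt]

theorem natDegree_quotQ_lt {i : Fin Γ.s} {m : ℕ} (hm : m < Γ.n i) :
    (Γ.quotQ i m).natDegree < Γ.N := by
  have h1 := congrArg natDegree (Γ.quotQ_mul hm)
  have hq : Γ.quotQ i m ≠ 0 := fun h => by
    have := Γ.quotQ_mul hm
    rw [h, mul_zero] at this
    exact Γ.Q_monic.ne_zero this.symm
  rw [natDegree_mul (pow_ne_zero _ (X_sub_C_ne_zero _)) hq, Γ.Q_natDegree] at h1
  simp at h1
  omega

/-- Reversing the columns turns the entries Q_{a+b+1} into Q_{N+a-b}: upper triangular with ones on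
the diagonal, as Q is monic of degree N. -/
theorem isUnit_det_Qmat : IsUnit Γ.Qmat.det := by
  have h : (Γ.Qmat.submatrix id Fin.revPerm).det = 1 := by
    rw [Matrix.det_of_isUpperTriangular]
    · refine Finset.prod_eq_one fun a _ => ?_
      simp only [submatrix_apply, id, Fin.revPerm_apply, Qmat, Matrix.of_apply, Fin.val_rev]
      rw [← Γ.Q_coeff_N]
      congr 1
      omega
    · intro a b hab
      simp only [submatrix_apply, id, Fin.revPerm_apply, Qmat, Matrix.of_apply, Fin.val_rev]
      refine coeff_eq_zero_of_natDegree_lt ?_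
      rw [Γ.Q_natDegree]
      simp only [id, Fin.lt_def] at hab
      omega
  rw [Matrix.det_permute'] at h
  exact IsUnit.of_mul_eq_one_right _ h

variable {Γ}

/-- Uniqueness in Hermite interpolation: a vector in the left kernel is a polynomial of degree less
than N vanishing to order n_i at each q_i. The nodes being distinct, it is divisible by Q, hence
zero. -/
theorem isUnit_det_germChi (hq : Function.Injective Γ.q) : IsUnit Γ.germChi.det := by
  refine isUnit_det_of_vecMul_eq_zero fun v hv => ?_
  set p : ℝ[X] := ∑ a, v a • X ^ (a : ℕ) with hp
  have hdvd : Γ.Q ∣ p := by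
    refine Finset.prod_dvd_of_coprime (fun i _ j _ hij => ?_) fun i _ => ?_
    · exact (isCoprime_X_sub_C_of_isUnit_sub
        (sub_ne_zero.mpr (hq.ne hij)).isUnit).pow
    · rw [X_sub_C_pow_dvd_iff, ← taylor_apply, X_pow_dvd_iff]
      intro m hm
      have h : ∀ c, (taylor (Γ.q (Γ.idx.symm c).1) p).coeff ((Γ.idx.symm c).2 : ℕ) = 0 := by
        intro c
        have hc := congrFun hv c
        simp only [Matrix.vecMul, dotProduct, germChi_apply, Pi.zero_apply] at hc
        rw [hp, map_sum, finsetSum_coeff, ← hc]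
        refine Finset.sum_congr rfl fun a _ => ?_
        rw [map_smul, coeff_smul, smul_eq_mul]
      have hi := h (Γ.idx ⟨i, ⟨m, hm⟩⟩)
      rwa [Equiv.symm_apply_apply] at hi
  have h0 : p = 0 := by
    refine eq_zero_of_dvd_of_degree_lt hdvd ?_
    rw [degree_eq_natDegree Γ.Q_monic.ne_zero, Γ.Q_natDegree]
    exact degree_sum_smul_X_pow_lt v
  ext a
  rw [← coeff_sum_smul_X_pow v a, ← hp, h0, coeff_zero, Pi.zero_apply]

theorem isUnit_det_Qmat_mul_germChi (hq : Function.Injective Γ.q) :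
    IsUnit (Γ.Qmat * Γ.germChi).det := by
  rw [Matrix.det_mul]
  exact Γ.isUnit_det_Qmat.mul (isUnit_det_germChi hq)

end GeronimusData

/-! ### The operator of multiplication by `x` on jets -/

/-- The jet `(u, u', …, u^{(K)})` at `x`. -/
noncomputable def jet (K : ℕ) (u : ℝ → ℝ) (x : ℝ) : Fin (K + 1) → ℝ :=
  fun b => iteratedDeriv b u x

theorem contDiff_eval (p : ℝ[X]) {n : WithTop ℕ∞} : ContDiff ℝ n fun x => p.eval x := by
  simpa using p.contDiff_aeval (𝕜 := ℝ) n

/-- Leibniz rule, all derivatives of z beyond the first being zero. For b = 0 the truncated index `b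
- 1` is multiplied by 0. -/
theorem iteratedDeriv_id_mul {u : ℝ → ℝ} {x : ℝ} (hu : ∀ n : ℕ, ContDiffAt ℝ n u x) (b : ℕ) :
    iteratedDeriv b (fun z => z * u z) x =
      x * iteratedDeriv b u x + b * iteratedDeriv (b - 1) u x := by
  cases b with
  | zero => simp
  | succ b =>
    rw [iteratedDeriv_fun_mul (f := fun z : ℝ => z) contDiffAt_id (hu (b + 1)), Finset.sum_range_succ',
      Finset.sum_range_succ']
    have h : ∀ i, iteratedDeriv (i + 1 + 1) (fun z : ℝ => z) x = 0 := fun i => by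
      have := congrFun (iteratedDeriv_polynomial_eval (X : ℝ[X]) (i + 1 + 1)) x
      simpa using this
    simp [h]
    ring

theorem mulX_transpose_mulVec_jet (K : ℕ) {u : ℝ → ℝ} {x : ℝ}
    (hu : ∀ n : ℕ, ContDiffAt ℝ n u x) :
    (mulX K x)ᵀ *ᵥ jet K u x = jet K (fun z => z * u z) x := by
  ext b
  simp only [jet, iteratedDeriv_id_mul hu, Matrix.mulVec, dotProduct, Matrix.transpose_apply,
    mulX, Matrix.of_apply]
  rcases b with ⟨_ | b, hb⟩
  · rw [Finset.sum_eq_single ⟨0, hb⟩]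
    · simp
    · intro j _ hj
      rw [if_neg hj]
      simp
    · simp
  · rw [Finset.sum_eq_add (⟨b + 1, hb⟩ : Fin (K + 1)) (⟨b, by omega⟩ : Fin (K + 1))]
    · simp
    · simp
    · rintro j - ⟨h1, h2⟩
      rw [if_neg h1, if_neg, zero_mul]
      intro h
      exact h2 (Fin.ext (by simpa using h))
    · simp
    · simp

/-- This is why the transformed measure involves Q(𝒳): multiplication of a function by P is the
matrix P(𝒳ᵀ) on jets, including the truncated ones. -/
theorem aeval_mulX_transpose_mulVec_jet (K : ℕ) (P : ℝ[X]) {x : ℝ} {u : ℝ → ℝ}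
    (hu : ∀ n : ℕ, ContDiffAt ℝ n u x) :
    aeval (mulX K x)ᵀ P *ᵥ jet K u x = jet K (fun z => P.eval z * u z) x := by
  induction P using Polynomial.induction_on generalizing u with
  | C a =>
    ext b
    simp [jet, Algebra.algebraMap_eq_smul_one, Matrix.smul_mulVec, iteratedDeriv_const_mul_field]
  | add p q hp hq =>
    rw [map_add, Matrix.add_mulVec, hp hu, hq hu]
    ext b
    simp only [jet, Pi.add_apply, eval_add, add_mul]
    rw [iteratedDeriv_fun_add]
    · exact (contDiff_eval p).contDiffAt.mul (hu b)
    · exact (contDiff_eval q).contDiffAt.mul (hu b)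
  | monomial n a ih =>
    -- The factor X is split off on the right so that it acts first on the jet, replacing u by z u;
    -- the induction hypothesis is stated for all u.
    have e : (C a * X ^ (n + 1) : ℝ[X]) = C a * X ^ n * X := by ring
    rw [e, map_mul, aeval_X, ← Matrix.mulVec_mulVec, mulX_transpose_mulVec_jet K hu,
      ih (u := fun z => z * u z) fun n => contDiffAt_id.mul (hu n)]
    simp only [eval_mul, eval_X, mul_assoc]

/-- The determinant of a polynomial in a matrix is multiplicative in the polynomial, so only the
triangular factors 𝒳ᵀ - q_i matter. -/
theorem det_aeval_mulX_transpose (K : ℕ) (x : ℝ) (Γ : GeronimusData) :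
    (aeval (mulX K x)ᵀ Γ.Q).det = Γ.Q.eval x ^ (K + 1) := by
  set φ : ℝ[X] →* ℝ := Matrix.detMonoidHom.comp
    ((aeval (mulX K x)ᵀ : ℝ[X] →ₐ[ℝ] _) : ℝ[X] →* Matrix (Fin (K + 1)) (Fin (K + 1)) ℝ) with hφ
  have h1 : ∀ q : ℝ, φ (X - C q) = (x - q) ^ (K + 1) := fun q => by
    simp only [hφ, MonoidHom.comp_apply, Matrix.coe_detMonoidHom, MonoidHom.coe_coe, map_sub,
      aeval_X, aeval_C]
    rw [Matrix.det_of_isLowerTriangular]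
    · simp [mulX, Matrix.algebraMap_matrix_apply]
    · intro i j hij
      have hij' : i < j := hij
      have h2 : (j : ℕ) + 1 ≠ i := by
        simp only [Fin.lt_def] at hij'
        omega
      simp [mulX, Matrix.algebraMap_matrix_apply, hij'.ne, hij'.ne', h2]
  have h2 : φ Γ.Q = Γ.Q.eval x ^ (K + 1) := by
    rw [GeronimusData.Q, map_prod, eval_prod, ← Finset.prod_pow]
    refine Finset.prod_congr rfl fun i _ => ?_
    rw [map_pow, h1, eval_pow, eval_sub, eval_X, eval_C, ← pow_mul, ← pow_mul, mul_comm]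
  exact h2

/-- Cramer's rule over ℝ[X]: the adjugate has polynomial entries and the determinant is a power of
Q. The density is therefore measurable, and on Ω it is a polynomial times a bounded function. -/
theorem exists_polynomial_inv_aeval_mulX (K : ℕ) (Γ : GeronimusData) (m b : Fin (K + 1)) :
    ∃ r : ℝ[X], ∀ x : ℝ, (aeval (mulX K x)ᵀ Γ.Q)⁻¹ m b =
      r.eval x * (Γ.Q.eval x ^ (K + 1))⁻¹ := by
  let M : Matrix (Fin (K + 1)) (Fin (K + 1)) ℝ[X] := Matrix.of fun j i =>
    if i = j then X else if (i : ℕ) + 1 = j then C (j : ℝ) else 0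
  refine ⟨(aeval M Γ.Q).adjugate m b, fun x => ?_⟩
  have hM : (mulX K x)ᵀ = (aeval x : ℝ[X] →ₐ[ℝ] ℝ).mapMatrix M := by
    ext i j
    simp only [Matrix.transpose_apply, mulX, Matrix.of_apply, AlgHom.mapMatrix_apply,
      Matrix.map_apply, M]
    split_ifs <;> simp
  -- The identity persists at the zeros of Q, where both inverses take the default value 0.
  rw [Matrix.inv_def, det_aeval_mulX_transpose, hM, aeval_algHom_apply, ← AlgHom.map_adjugate,
    Ring.inverse_eq_inv', Matrix.smul_apply, smul_eq_mul, mul_comm,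
    AlgHom.mapMatrix_apply, Matrix.map_apply, coe_aeval_eq_eval]

namespace GeronimusData

variable (Γ : GeronimusData)

/-! ### The discrete part -/

/-- The bilinear form of the discrete part. -/
noncomputable def massForm (p g : ℝ[X]) : ℝ :=
  ∑ i, ∑ a : Fin (Γ.n i), ∑ b : Fin (Γ.n i),
    Γ.ξ i a b * ((taylor (Γ.q i) p).coeff a * (taylor (Γ.q i) g).coeff b)

theorem massForm_Q_mul (p g : ℝ[X]) : Γ.massForm p (Γ.Q * g) = 0 :=
  Finset.sum_eq_zero fun i _ => Finset.sum_eq_zero fun a _ => Finset.sum_eq_zero fun b _ => by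
    rw [Γ.taylor_Q_coeff b.isLt, mul_zero, mul_zero]

theorem integrable_dirac_vectorMeasure (q v : ℝ) (f : ℝ → ℝ) :
    (VectorMeasure.dirac q v : SignedMeasure ℝ).Integrable f := by
  rw [VectorMeasure.Integrable, VectorMeasure.variation_dirac]
  exact (integrable_dirac (by simp)).smul_measure (by simp)

theorem integrable_massEntry (a b : ℕ) (f : ℝ → ℝ) : (Γ.massEntry a b).Integrable f := by
  refine VectorMeasure.Integrable.finsetSum_vectorMeasure fun i _ => ?_
  split_ifs
  · exact integrable_dirac_vectorMeasure _ _ _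
  · exact VectorMeasure.Integrable.zero_vectorMeasure

theorem integral_massEntry (a b : ℕ) (f : ℝ → ℝ) :
    (Γ.massEntry a b).integral f (ContinuousLinearMap.lsmul ℝ ℝ) =
      ∑ i, if hab : a < Γ.n i ∧ b < Γ.n i then
        Γ.ξ i ⟨a, hab.1⟩ ⟨b, hab.2⟩ / ((a.factorial : ℝ) * b.factorial) * f (Γ.q i) else 0 := by
  rw [massEntry, VectorMeasure.integral_finsetSum_vectorMeasure]
  · refine Finset.sum_congr rfl fun i _ => ?_
    split_ifs
    · rw [VectorMeasure.integral_dirac]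
      simp [mul_comm]
    · simp
  · intro i _
    split_ifs
    · exact integrable_dirac_vectorMeasure _ _ _
    · exact VectorMeasure.Integrable.zero_vectorMeasure

theorem taylor_coeff_eq_div (q : ℝ) (p : ℝ[X]) (a : ℕ) :
    (taylor q p).coeff a = (Polynomial.derivative^[a] p).eval q / a.factorial := by
  rw [taylor_coeff, ← factorial_smul_hasseDeriv]
  simp only [LinearMap.smul_apply, eval_smul]
  rw [nsmul_eq_mul, mul_div_cancel_left₀]
  positivity

/-- The weights 1/(a! b!) of the masses turn derivatives into Taylor coefficients. The summation
range may exceed n_i, where the masses are zero. -/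
theorem sum_integral_massEntry {k : ℕ} (hk : ∀ i, Γ.n i ≤ k) (p g : ℝ[X]) :
    ∑ a ∈ Finset.range (k + 1), ∑ b ∈ Finset.range (k + 1), (Γ.massEntry a b).integral
      (fun x => (Polynomial.derivative^[a] p).eval x * (Polynomial.derivative^[b] g).eval x)
      (ContinuousLinearMap.lsmul ℝ ℝ) = Γ.massForm p g := by
  simp only [integral_massEntry, massForm]
  have h1 : ∀ a, ∀ F : ℕ → Fin Γ.s → ℝ, ∑ b ∈ Finset.range a, ∑ i, F b i =
    ∑ i, ∑ b ∈ Finset.range a, F b i := fun a F => Finset.sum_comm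
  simp only [h1]
  refine Finset.sum_congr rfl fun i _ => ?_
  have h2 : ∀ F : ℕ → ℝ, (∀ a, Γ.n i ≤ a → F a = 0) →
      ∑ a ∈ Finset.range (k + 1), F a = ∑ a : Fin (Γ.n i), F a := by
    intro F hF
    rw [← Finset.sum_range F]
    symm
    refine Finset.sum_subset (fun a ha => ?_) fun a _ ha => ?_
    · have := hk i
      simp only [Finset.mem_range] at *
      omega
    · exact hF a (by simpa using ha)
  rw [h2 _ fun a ha => Finset.sum_eq_zero fun b _ => dif_neg (by omega)]
  refine Finset.sum_congr rfl fun a _ => ?_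
  rw [h2 _ fun b hb => dif_neg (by omega)]
  refine Finset.sum_congr rfl fun b _ => ?_
  rw [dif_pos ⟨a.isLt, b.isLt⟩, taylor_coeff_eq_div, taylor_coeff_eq_div]
  have := Nat.factorial_ne_zero a
  field_simp

/-- Near q_i the quotient is (x - q_i)^{n_i-1-m} Q_i(x), so its coefficient of order b is that of
Q_i of order m - (n_i - 1 - b). The exchange matrix performs b ↦ n_i - 1 - b. -/
theorem taylor_quotQ_coeff (i : Fin Γ.s) (m b : Fin (Γ.n i)) :
    (taylor (Γ.q i) (Γ.quotQ i m)).coeff b = (eta (Γ.n i) * Γ.taylorQ i) b m := by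
  have hb := b.isLt
  have hm := m.isLt
  rw [quotQ, taylor_mul, taylor_X_sub_C_pow, coeff_X_pow_mul', Matrix.mul_apply,
    Finset.sum_eq_single ⟨Γ.n i - 1 - b, by omega⟩]
  · simp only [eta, taylorQ, Matrix.of_apply]
    rw [if_pos (show (b : ℕ) + (Γ.n i - 1 - b) + 1 = Γ.n i by omega), one_mul]
    split_ifs with h1 h2 h2
    · rw [← taylor_coeff_eq_div]
      congr 1
      omega
    · omega
    · omega
    · rfl
  · intro j _ hj
    rw [eta, Matrix.of_apply, if_neg, zero_mul]
    intro h
    exact hj (Fin.ext (by simp; omega))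
  · simp

/-- The full factor (x - q_i)^{n_i} survives in a quotient taken at another node. This makes Ξ_R
block diagonal. -/
theorem taylor_quotQ_coeff_of_ne {i j : Fin Γ.s} (hij : i ≠ j) (m : ℕ) (b : Fin (Γ.n i)) :
    (taylor (Γ.q i) (Γ.quotQ j m)).coeff b = 0 := by
  rw [quotQ, Qdiv, ← Finset.mul_prod_erase _ _ (Finset.mem_erase.mpr ⟨hij, Finset.mem_univ i⟩),
    mul_left_comm, taylor_mul, taylor_X_sub_C_pow, coeff_X_pow_mul', if_neg (by omega)]

theorem massForm_quotQ (p : ℝ[X]) (c : Fin Γ.N) :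
    Γ.massForm p (Γ.quotQ (Γ.idx.symm c).1 (Γ.idx.symm c).2) =
      (Γ.germ (fun x => p.eval x) ᵥ* Γ.XiR) c := by
  simp only [Matrix.vecMul, dotProduct, germ_eval, XiR, Matrix.submatrix_apply]
  rw [Equiv.sum_comp Γ.idx.symm fun x : (i : Fin Γ.s) × Fin (Γ.n i) =>
    (taylor (Γ.q x.1) p).coeff (x.2 : ℕ) *
      Matrix.blockDiagonal' (fun j => Γ.ξ j * eta (Γ.n j) * Γ.taylorQ j) x (Γ.idx.symm c)]
  obtain ⟨j, m⟩ := Γ.idx.symm c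
  rw [Fintype.sum_sigma, massForm]
  refine Finset.sum_congr rfl fun i _ => Finset.sum_congr rfl fun a _ => ?_
  by_cases hij : i = j
  · subst hij
    rw [Matrix.blockDiagonal'_apply_eq, Matrix.mul_assoc, Matrix.mul_apply, Finset.mul_sum]
    refine Finset.sum_congr rfl fun b _ => ?_
    rw [taylor_quotQ_coeff]
    ring
  · rw [Matrix.blockDiagonal'_apply_ne _ _ _ hij, mul_zero]
    refine Finset.sum_eq_zero fun b _ => ?_
    rw [Γ.taylor_quotQ_coeff_of_ne hij, mul_zero, mul_zero]

end GeronimusData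

/-! ### The bilinear form of a moment matrix -/

/-- The bilinear form on polynomials with Gram matrix `G`. -/
noncomputable def bil (G : Matrix ℕ ℕ ℝ) : ℝ[X] →ₗ[ℝ] ℝ[X] →ₗ[ℝ] ℝ :=
  (basisMonomials ℝ).constr ℝ fun i => (basisMonomials ℝ).constr ℝ fun j => G i j

theorem basisMonomials_eq_X_pow (i : ℕ) : basisMonomials ℝ i = X ^ i := by
  rw [coe_basisMonomials, X_pow_eq_monomial]

theorem bil_X_pow (G : Matrix ℕ ℕ ℝ) (i j : ℕ) : bil G (X ^ i) (X ^ j) = G i j := by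
  rw [← basisMonomials_eq_X_pow, ← basisMonomials_eq_X_pow, bil, Module.Basis.constr_basis,
    Module.Basis.constr_basis]

theorem bil_X_pow_left (G : Matrix ℕ ℕ ℝ) (i : ℕ) (g : ℝ[X]) :
    bil G (X ^ i) g = ∑ j ∈ Finset.range (g.natDegree + 1), g.coeff j * G i j := by
  conv_lhs => rw [g.as_sum_range_C_mul_X_pow]
  rw [map_sum]
  refine Finset.sum_congr rfl fun j _ => ?_
  rw [← smul_eq_C_mul, map_smul, bil_X_pow, smul_eq_mul]

theorem sum_sum_range_of_eq_zero {k l : ℕ} (hkl : k ≤ l) {F : ℕ → ℕ → ℝ}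
    (hF : ∀ a b, k ≤ a ∨ k ≤ b → F a b = 0) :
    ∑ a ∈ Finset.range l, ∑ b ∈ Finset.range l, F a b =
      ∑ a ∈ Finset.range k, ∑ b ∈ Finset.range k, F a b := by
  have hsub := Finset.range_mono hkl
  rw [← Finset.sum_subset hsub]
  · refine Finset.sum_congr rfl fun a _ => (Finset.sum_subset hsub fun b _ hb => ?_).symm
    exact hF a b (Or.inr (by simpa using hb))
  · intro a _ ha
    exact Finset.sum_eq_zero fun b _ => hF a b (Or.inl (by simpa using ha))

namespace MeasureMatrix

variable {W : MeasureMatrix}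

theorem Admissible.form_eq_of_X_pow {u : ℝ → ℝ} (hu : W.Admissible u) {L : ℝ[X] →ₗ[ℝ] ℝ}
    (hL : ∀ i, L (X ^ i) = W.form (fun x => x ^ i) u) (p : ℝ[X]) :
    W.form (fun x => p.eval x) u = L p := by
  have h := hu.form_sum (Finset.range (p.natDegree + 1)) p.coeff fun i => X ^ i
  have e : ∑ i ∈ Finset.range (p.natDegree + 1), p.coeff i • (X : ℝ[X]) ^ i = p := by
    simp only [smul_eq_C_mul]
    exact p.as_sum_range_C_mul_X_pow.symm
  rw [e] at h
  rw [h]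
  conv_rhs => rw [← e, map_sum]
  refine Finset.sum_congr rfl fun i _ => ?_
  rw [map_smul, hL, smul_eq_mul]
  simp

theorem HasFiniteMoments.form_eval_eval (hW : W.HasFiniteMoments) (p g : ℝ[X]) :
    W.form (fun x => p.eval x) (fun x => g.eval x) = bil W.moment p g := by
  refine (hW.admissible_eval g).form_eq_of_X_pow (L := (bil W.moment).flip g) (fun i => ?_) p
  rw [LinearMap.flip_apply, bil_X_pow_left, hW.form_eval_right]

/-! ### The right transformed measure matrix -/

variable {Γ : GeronimusData}

theorem boundedOmega_inv_Q (hΩ : ∀ i, Γ.q i ∉ W.Omega) :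
    W.BoundedOmega fun x => (Γ.Q.eval x)⁻¹ := by
  have h := BoundedOmega.prod Finset.univ fun i =>
    (boundedOmega_inv_sub (hΩ i)).pow (Γ.n i)
  convert h using 2 with x
  simp [GeronimusData.Q, eval_prod]

theorem Q_eval_ne_zero (hΩ : ∀ i, Γ.q i ∉ W.Omega) {x : ℝ} (hx : x ∈ W.Omega) :
    Γ.Q.eval x ≠ 0 := by
  rw [GeronimusData.Q, eval_prod, Finset.prod_ne_zero_iff]
  intro i _
  simpa using fun h => absurd (sub_eq_zero.mp h) (ne_of_mem_of_not_mem hx (hΩ i))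

/-- The absolutely continuous part of the right transformed measure matrix. -/
noncomputable def densityR (W : MeasureMatrix) (Γ : GeronimusData) (a b : ℕ) : SignedMeasure ℝ :=
  if hb : b < W.order + 1 then
    ∑ m : Fin (W.order + 1), (W.entry a m).withDensity
      (fun x => (aeval (mulX W.order x)ᵀ Γ.Q)⁻¹ m ⟨b, hb⟩) (ContinuousLinearMap.lsmul ℝ ℝ)
  else 0

theorem geronimusR_entry (a b : ℕ) :
    (W.geronimusR Γ).entry a b = W.densityR Γ a b + Γ.massEntry a b := rfl

theorem measurable_density (K : ℕ) (m b : Fin (K + 1)) :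
    Measurable fun x => (aeval (mulX K x)ᵀ Γ.Q)⁻¹ m b := by
  obtain ⟨r, hr⟩ := exists_polynomial_inv_aeval_mulX K Γ m b
  simp only [hr]
  have h1 : Measurable fun x => r.eval x := r.continuous.measurable
  have h2 : Measurable fun x => Γ.Q.eval x := Γ.Q.continuous.measurable
  fun_prop

theorem HasFiniteMoments.integrable_eval_mul_density (hW : W.HasFiniteMoments)
    (hΩ : ∀ i, Γ.q i ∉ W.Omega) (a c K : ℕ) (m b : Fin (K + 1)) (p : ℝ[X]) :
    (W.entry a c).Integrable fun x => p.eval x * (aeval (mulX K x)ᵀ Γ.Q)⁻¹ m b := by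
  obtain ⟨r, hr⟩ := exists_polynomial_inv_aeval_mulX K Γ m b
  have h := hW.integrable_mul a c (p * r) ((boundedOmega_inv_Q hΩ).pow (K + 1))
  convert h using 2 with x
  rw [hr, eval_mul, inv_pow, mul_assoc]

theorem HasFiniteMoments.integral_withDensity (hW : W.HasFiniteMoments)
    (hΩ : ∀ i, Γ.q i ∉ W.Omega) (a c K : ℕ) (m b : Fin (K + 1)) (p : ℝ[X]) :
    ((W.entry a c).withDensity (fun x => (aeval (mulX K x)ᵀ Γ.Q)⁻¹ m b)
      (ContinuousLinearMap.lsmul ℝ ℝ)).Integrable (fun x => p.eval x) ∧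
    ((W.entry a c).withDensity (fun x => (aeval (mulX K x)ᵀ Γ.Q)⁻¹ m b)
      (ContinuousLinearMap.lsmul ℝ ℝ)).integral (fun x => p.eval x)
        (ContinuousLinearMap.lsmul ℝ ℝ) =
      (W.entry a c).integral (fun x => p.eval x * (aeval (mulX K x)ᵀ Γ.Q)⁻¹ m b)
        (ContinuousLinearMap.lsmul ℝ ℝ) :=
  SignedIntegral.integral_withDensity (measurable_density K m b)
    (by simpa using hW.integrable_eval_mul_density hΩ a c K m b 1)
    (hW.integrable_eval_mul_density hΩ a c K m b p)

theorem HasFiniteMoments.integrable_densityR (hW : W.HasFiniteMoments)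
    (hΩ : ∀ i, Γ.q i ∉ W.Omega) (a b : ℕ) (p : ℝ[X]) :
    (W.densityR Γ a b).Integrable fun x => p.eval x := by
  rw [densityR]
  split_ifs
  · exact VectorMeasure.Integrable.finsetSum_vectorMeasure fun m _ =>
      (hW.integral_withDensity hΩ _ _ _ _ _ _).1
  · exact VectorMeasure.Integrable.zero_vectorMeasure

theorem HasFiniteMoments.geronimusR (hW : W.HasFiniteMoments)
    (hΩ : ∀ i, Γ.q i ∉ W.Omega) : (W.geronimusR Γ).HasFiniteMoments := by
  intro a b k
  rw [geronimusR_entry]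
  refine VectorMeasure.Integrable.add_vectorMeasure ?_ (Γ.integrable_massEntry a b _)
  simpa using hW.integrable_densityR hΩ a b (X ^ k)

/-- On Ω the jet of g is Q(𝒳ᵀ) times the jet of u, and the density cancels this matrix. The
factorization g = Q u is needed only near Ω, so u may have poles at the q_i. -/
theorem HasFiniteMoments.sum_integral_densityR (hW : W.HasFiniteMoments)
    (hΩ : ∀ i, Γ.q i ∉ W.Omega) (a : ℕ) (p g : ℝ[X]) {u : ℝ → ℝ}
    (hsm : ∀ x ∈ W.Omega, ∀ n : ℕ, ContDiffAt ℝ n u x)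
    (hg : ∀ x ∈ W.Omega, ∀ᶠ z in nhds x, g.eval z = Γ.Q.eval z * u z) :
    ∑ b ∈ Finset.range (W.order + 1), (W.densityR Γ a b).integral
      (fun x => p.eval x * (Polynomial.derivative^[b] g).eval x)
      (ContinuousLinearMap.lsmul ℝ ℝ) =
    ∑ m ∈ Finset.range (W.order + 1), (W.entry a m).integral
      (fun x => p.eval x * iteratedDeriv m u x) (ContinuousLinearMap.lsmul ℝ ℝ) := by
  set K := W.order with hK
  have h1 : ∀ b : Fin (K + 1), (W.densityR Γ a b).integral
      (fun x => p.eval x * (Polynomial.derivative^[(b : ℕ)] g).eval x)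
      (ContinuousLinearMap.lsmul ℝ ℝ) = ∑ m : Fin (K + 1), (W.entry a m).integral
        (fun x => p.eval x * ((aeval (mulX K x)ᵀ Γ.Q)⁻¹ m b *
          (Polynomial.derivative^[(b : ℕ)] g).eval x)) (ContinuousLinearMap.lsmul ℝ ℝ) := by
    intro b
    simp only [← eval_mul]
    rw [densityR, dif_pos (by omega), VectorMeasure.integral_finsetSum_vectorMeasure
      fun m _ => (hW.integral_withDensity hΩ _ _ _ _ _ _).1]
    refine Finset.sum_congr rfl fun m _ => ?_
    rw [(hW.integral_withDensity hΩ _ _ _ _ _ _).2]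
    congr 1
    ext x
    rw [eval_mul]
    ring
  rw [Finset.sum_range, Finset.sum_range]
  simp only [h1]
  rw [Finset.sum_comm]
  refine Finset.sum_congr rfl fun m _ => ?_
  rw [← VectorMeasure.integral_finsetSum]
  · refine VectorMeasure.integral_congr_ae ?_
    filter_upwards [W.ae_mem_Omega a m] with x hx
    rw [← Finset.mul_sum]
    congr 1
    -- Off Ω the matrix may be singular and its inverse a default value; almost every point lies in
    -- Ω.
    have hdet : IsUnit (aeval (mulX K x)ᵀ Γ.Q).det := by
      rw [det_aeval_mulX_transpose, isUnit_iff_ne_zero]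
      exact pow_ne_zero _ (Q_eval_ne_zero hΩ hx)
    have hj : jet K (fun z => Γ.Q.eval z * u z) x =
        fun b : Fin (K + 1) => (Polynomial.derivative^[(b : ℕ)] g).eval x := by
      ext b
      rw [jet, ← congrFun (iteratedDeriv_polynomial_eval g b) x]
      have he : (fun z => Γ.Q.eval z * u z) =ᶠ[nhds x] fun z => g.eval z :=
        (hg x hx).mono fun z hz => hz.symm
      exact he.iteratedDeriv_eq b
    have h2 := aeval_mulX_transpose_mulVec_jet K Γ.Q (hsm x hx)
    rw [hj] at h2
    have h3 := congrArg (fun v => (aeval (mulX K x)ᵀ Γ.Q)⁻¹ *ᵥ v) h2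
    simp only [Matrix.mulVec_mulVec, Matrix.nonsing_inv_mul _ hdet, Matrix.one_mulVec] at h3
    exact (congrFun h3 m).symm
  · intro b _
    refine (hW.integrable_eval_mul_density hΩ a m K m b
      (p * Polynomial.derivative^[(b : ℕ)] g)).congr (Filter.Eventually.of_forall fun x => ?_)
    simp only [eval_mul]
    ring

theorem HasFiniteMoments.form_geronimusR (hW : W.HasFiniteMoments)
    (hΩ : ∀ i, Γ.q i ∉ W.Omega) (p g : ℝ[X]) {u : ℝ → ℝ}
    (hsm : ∀ x ∈ W.Omega, ∀ n : ℕ, ContDiffAt ℝ n u x)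
    (hg : ∀ x ∈ W.Omega, ∀ᶠ z in nhds x, g.eval z = Γ.Q.eval z * u z) :
    bil (W.geronimusR Γ).moment p g = W.form (fun x => p.eval x) u + Γ.massForm p g := by
  have hle : ∀ i, Γ.n i ≤ (W.geronimusR Γ).order := fun i =>
    (Finset.le_sup (f := Γ.n) (Finset.mem_univ i)).trans (le_max_right _ _)
  have hW' : W.order ≤ (W.geronimusR Γ).order := le_max_left _ _
  rw [← (hW.geronimusR hΩ).form_eval_eval, form_comm_eval, form_comm_eval,
    ← Γ.sum_integral_massEntry hle]
  simp only [iteratedDeriv_polynomial_eval, geronimusR_entry]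
  have h1 : ∀ a b : ℕ, (W.densityR Γ a b + Γ.massEntry a b).integral
      (fun x => (Polynomial.derivative^[a] p).eval x * (Polynomial.derivative^[b] g).eval x)
      (ContinuousLinearMap.lsmul ℝ ℝ) =
      (W.densityR Γ a b).integral
      (fun x => (Polynomial.derivative^[a] p).eval x * (Polynomial.derivative^[b] g).eval x)
      (ContinuousLinearMap.lsmul ℝ ℝ) + (Γ.massEntry a b).integral
      (fun x => (Polynomial.derivative^[a] p).eval x * (Polynomial.derivative^[b] g).eval x)
      (ContinuousLinearMap.lsmul ℝ ℝ) := fun a b => by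
    simp only [← eval_mul]
    exact VectorMeasure.integral_add_vectorMeasure (hW.integrable_densityR hΩ a b _)
      (Γ.integrable_massEntry a b _)
  simp only [h1, Finset.sum_add_distrib]
  rw [add_left_inj]
  have hz : ∀ a b, W.order < a ∨ W.order < b → W.densityR Γ a b = 0 := by
    intro a b h
    rw [densityR]
    split_ifs with hb
    · refine Finset.sum_eq_zero fun m _ => ?_
      rw [W.entry_eq_zero a m (Or.inl (by omega)), VectorMeasure.withDensity_zero_vectorMeasure]
    · rfl
  -- The order of the transformed matrix also accounts for the masses and may exceed that of W; the
  -- density contributes nothing there.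
  rw [sum_sum_range_of_eq_zero (Nat.succ_le_succ hW')]
  · exact Finset.sum_congr rfl fun a _ => hW.sum_integral_densityR hΩ a _ g hsm hg
  · intro a b h
    rw [hz a b (by omega), VectorMeasure.integral_zero_vectorMeasure]

/-- `(p, Q g)_R = (p, g)`. -/
theorem HasFiniteMoments.bil_geronimusR_Q_mul (hW : W.HasFiniteMoments)
    (hΩ : ∀ i, Γ.q i ∉ W.Omega) (p g : ℝ[X]) :
    bil (W.geronimusR Γ).moment p (Γ.Q * g) = bil W.moment p g := by
  rw [hW.form_geronimusR hΩ p (Γ.Q * g)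
    (fun x _ n => (contDiff_eval g).contDiffAt)
    (fun x _ => Filter.Eventually.of_forall fun z => eval_mul), hW.form_eval_eval,
    Γ.massForm_Q_mul, add_zero]

/-- Here u is the pole (x - q_i)^{-m-1}: the integral part is a derivative of the second kind
function at q_i divided by -m!, and the mass part is the entry of Π_q[p] Ξ_R. -/
theorem HasFiniteMoments.bil_geronimusR_quotQ (hW : W.HasFiniteMoments)
    (hΩ : ∀ i, Γ.q i ∉ W.Omega) (p : ℝ[X]) (c : Fin Γ.N) :
    bil (W.geronimusR Γ).moment p (Γ.quotQ (Γ.idx.symm c).1 (Γ.idx.symm c).2) =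
      -Γ.germDiff Γ.XiR (fun y => W.form (fun x => p.eval x) (fun x => 1 / (y - x)))
        (fun x => p.eval x) c := by
  have hq := hΩ (Γ.idx.symm c).1
  rw [hW.form_geronimusR hΩ p (u := fun x => ((x - Γ.q (Γ.idx.symm c).1) ^
    (((Γ.idx.symm c).2 : ℕ) + 1))⁻¹) _, Γ.massForm_quotQ,
    GeronimusData.germDiff, Pi.sub_apply, neg_sub, sub_eq_add_neg, add_comm]
  · congr 1
    rw [GeronimusData.germ, hW.iteratedDeriv_form_one_div p _ hq]
    have := Nat.factorial_ne_zero (Γ.idx.symm c).2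
    field_simp
  · intro x hx n
    have hx' : (x - Γ.q (Γ.idx.symm c).1) ^ (((Γ.idx.symm c).2 : ℕ) + 1) ≠ 0 :=
      pow_ne_zero _ (sub_ne_zero.mpr (ne_of_mem_of_not_mem hx hq))
    refine ContDiffAt.inv ?_ hx'
    fun_prop
  · intro x hx
    have hx' : x ≠ Γ.q (Γ.idx.symm c).1 := ne_of_mem_of_not_mem hx hq
    filter_upwards [isOpen_ne.mem_nhds hx'] with z hz
    have hz' : z - Γ.q (Γ.idx.symm c).1 ≠ 0 := sub_ne_zero.mpr hz
    have h := congrArg (eval z) (Γ.quotQ_mul (Γ.idx.symm c).2.isLt)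
    rw [eval_mul, eval_pow, eval_sub, eval_X, eval_C] at h
    rw [← h]
    field_simp

/-- `Π_q[C] - Π_q[p] Ξ_R` in terms of the transformed moments. -/
theorem HasFiniteMoments.germDiff_XiR (hW : W.HasFiniteMoments)
    (hΩ : ∀ i, Γ.q i ∉ W.Omega) (p : ℝ[X]) :
    Γ.germDiff Γ.XiR (fun y => W.form (fun x => p.eval x) (fun x => 1 / (y - x)))
        (fun x => p.eval x) =
      -((fun a : Fin Γ.N => bil (W.geronimusR Γ).moment p (X ^ (a : ℕ))) ᵥ*
        (Γ.Qmat * Γ.germChi)) := by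
  ext c
  rw [← neg_inj, ← hW.bil_geronimusR_quotQ hΩ, Pi.neg_apply, neg_neg,
    (Γ.quotQ _ _).as_sum_range' Γ.N (Γ.natDegree_quotQ_lt (Γ.idx.symm c).2.isLt), Finset.sum_range,
    map_sum, Matrix.vecMul, dotProduct]
  refine Finset.sum_congr rfl fun a _ => ?_
  rw [← C_mul_X_pow_eq_monomial, ← smul_eq_C_mul, map_smul, Γ.coeff_quotQ, smul_eq_mul, mul_comm]

end MeasureMatrix

/-! ### Bi-orthogonality -/

theorem monicPoly_eq_sum (S : Matrix ℕ ℕ ℝ) (hS : IsLowerUnitriangular S) {k n : ℕ} (h : k < n) :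
    monicPoly S k = ∑ i ∈ Finset.range n, S k i • (X : ℝ[X]) ^ i := by
  simp only [monicPoly, smul_eq_C_mul]
  refine Finset.sum_subset (Finset.range_mono h) fun i _ hi => ?_
  rw [hS.1 k i (by simpa using hi), C_0, zero_mul]

theorem IsLowerUnitriangular.monicPoly_eq {S : Matrix ℕ ℕ ℝ} (hS : IsLowerUnitriangular S)
    (k : ℕ) : monicPoly S k = X ^ k + ∑ i : Fin k, S k i • (X : ℝ[X]) ^ (i : ℕ) := by
  rw [monicPoly_eq_sum S hS k.lt_succ_self, Finset.sum_range_succ, hS.2, one_smul, add_comm,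
    Finset.sum_range]

theorem IsLowerUnitriangular.degree_monicPoly_sub_lt {S : Matrix ℕ ℕ ℝ}
    (hS : IsLowerUnitriangular S) (k : ℕ) : (monicPoly S k - (X : ℝ[X]) ^ k).degree < k := by
  rw [hS.monicPoly_eq, add_sub_cancel_left]
  exact degree_sum_smul_X_pow_lt _

theorem IsLowerUnitriangular.monic_monicPoly {S : Matrix ℕ ℕ ℝ}
    (hS : IsLowerUnitriangular S) (k : ℕ) : (monicPoly S k).Monic := by
  have := monic_X_pow_add (hS.degree_monicPoly_sub_lt k)
  rwa [add_sub_cancel] at this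

theorem IsLowerUnitriangular.degree_monicPoly {S : Matrix ℕ ℕ ℝ}
    (hS : IsLowerUnitriangular S) (k : ℕ) : (monicPoly S k).degree = k := by
  have h1 := hS.degree_monicPoly_sub_lt k
  have h2 := degree_add_eq_left_of_degree_lt (h1.trans_eq (degree_X_pow (R := ℝ) k).symm)
  rwa [add_sub_cancel, degree_X_pow] at h2

theorem degree_sub_lt_of_monic {p q : ℝ[X]} {k : ℕ} (hp : p.Monic) (hq : q.Monic)
    (hpk : p.degree = k) (hqk : q.degree = k) : (p - q).degree < k := by
  rw [← hpk]
  exact degree_sub_lt_left (hpk.trans hqk.symm) hp.ne_zero (hp.leadingCoeff.trans hq.leadingCoeff.symm)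

theorem IsLowerUnitriangular.exists_eq_sum {S : Matrix ℕ ℕ ℝ} (hS : IsLowerUnitriangular S)
    (k : ℕ) {p : ℝ[X]} (hp : p.degree < k) :
    ∃ c : ℕ → ℝ, p = ∑ m ∈ Finset.range k, c m • monicPoly S m := by
  induction k generalizing p with
  | zero =>
    refine ⟨0, ?_⟩
    simpa [Nat.WithBot.lt_zero_iff] using hp
  | succ k ih =>
    have h : (p - p.coeff k • monicPoly S k).degree < k := by
      rw [degree_lt_iff_coeff_zero] at hp ⊢
      intro m hm
      rw [coeff_sub, coeff_smul, smul_eq_mul]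
      rcases hm.eq_or_lt with rfl | hm
      · have : (monicPoly S k).coeff k = 1 := by
          have := (hS.monic_monicPoly k).coeff_natDegree
          rwa [natDegree_eq_of_degree_eq_some (hS.degree_monicPoly k)] at this
        rw [this, mul_one, sub_self]
      · have : (monicPoly S k).coeff m = 0 := coeff_eq_zero_of_degree_lt (by
          rw [hS.degree_monicPoly]; exact Nat.cast_lt.mpr hm)
        rw [hp m hm, this, mul_zero, sub_zero]
    obtain ⟨c, hc⟩ := ih h
    refine ⟨fun m => if m = k then p.coeff k else c m, ?_⟩
    rw [Finset.sum_range_succ]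
    simp only [if_true]
    rw [← sub_eq_iff_eq_add, hc]
    refine Finset.sum_congr rfl fun m hm => ?_
    rw [if_neg (Finset.mem_range.mp hm).ne]

theorem bil_transpose (G : Matrix ℕ ℕ ℝ) (p q : ℝ[X]) : bil Gᵀ p q = bil G q p := by
  have : bil Gᵀ = (bil G).flip := by
    refine (basisMonomials ℝ).ext fun i => (basisMonomials ℝ).ext fun j => ?_
    rw [LinearMap.flip_apply]
    simp only [basisMonomials_eq_X_pow, bil_X_pow, Matrix.transpose_apply]
  rw [this, LinearMap.flip_apply]

theorem bil_eq_zero_of_X_pow {G : Matrix ℕ ℕ ℝ} {p : ℝ[X]} {k : ℕ}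
    (h : ∀ a < k, bil G p (X ^ a) = 0) {g : ℝ[X]} (hg : g.degree < k) : bil G p g = 0 := by
  rcases eq_or_ne g 0 with rfl | hg0
  · rw [map_zero]
  rw [g.as_sum_range' k ((natDegree_lt_iff_degree_lt hg0).mpr hg), map_sum]
  refine Finset.sum_eq_zero fun a ha => ?_
  rw [← C_mul_X_pow_eq_monomial, ← smul_eq_C_mul, map_smul, h a (Finset.mem_range.mp ha),
    smul_zero]

theorem IsLowerUnitriangular.isUnit_det_trunc {S : Matrix ℕ ℕ ℝ} (hS : IsLowerUnitriangular S)
    (k : ℕ) : IsUnit (trunc k S).det := by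
  rw [Matrix.det_of_isLowerTriangular (trunc k S) (fun i j hij => hS.1 _ _ hij)]
  simp [trunc, hS.2]

namespace IsLU

variable {G S₁ S₂ : Matrix ℕ ℕ ℝ} {h : ℕ → ℝ}

theorem transpose (hS : IsLU G S₁ S₂ h) : IsLU Gᵀ S₂ S₁ h := by
  refine ⟨hS.lower₂, hS.lower₁, fun k => ?_⟩
  have e : trunc k Gᵀ = (trunc k G)ᵀ := rfl
  rw [e, hS.factor k, Matrix.transpose_mul, Matrix.transpose_mul, Matrix.transpose_transpose,
    Matrix.diagonal_transpose, Matrix.mul_assoc]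

theorem bil_monicPoly (hS : IsLU G S₁ S₂ h) (k l : ℕ) :
    bil G (monicPoly S₁ k) (monicPoly S₂ l) = if k = l then h k else 0 := by
  -- The factorization is given on truncations only, so one containing both indices is chosen.
  obtain ⟨n, hk, hl⟩ : ∃ n, k < n ∧ l < n := ⟨max k l + 1, by omega, by omega⟩
  have h1 : trunc n S₁ * trunc n G * (trunc n S₂)ᵀ = Matrix.diagonal fun i : Fin n => h i := by
    rw [hS.factor n, Matrix.transpose_nonsing_inv, ← Matrix.mul_assoc, ← Matrix.mul_assoc,
      Matrix.mul_nonsing_inv _ (hS.lower₁.isUnit_det_trunc n), Matrix.one_mul, Matrix.mul_assoc,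
      Matrix.nonsing_inv_mul _ (by
        rw [Matrix.det_transpose]; exact hS.lower₂.isUnit_det_trunc n), Matrix.mul_one]
  have h2 := congrFun (congrFun h1 ⟨k, hk⟩) ⟨l, hl⟩
  rw [Matrix.diagonal_apply] at h2
  simp only [Fin.mk.injEq] at h2
  rw [← h2, monicPoly_eq_sum S₁ hS.lower₁ hk, monicPoly_eq_sum S₂ hS.lower₂ hl, Matrix.mul_apply,
    map_sum, Finset.sum_range]
  refine Finset.sum_congr rfl fun j _ => ?_
  rw [map_smul, map_sum, LinearMap.sum_apply, Finset.sum_range, Matrix.mul_apply, smul_eq_mul,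
    mul_comm]
  congr 1
  refine Finset.sum_congr rfl fun i _ => ?_
  rw [map_smul, LinearMap.smul_apply, bil_X_pow, smul_eq_mul]
  rfl

theorem ne_zero (hS : IsLU G S₁ S₂ h) (hG : LUFactorizable G) (k : ℕ) : h k ≠ 0 := by
  intro h0
  refine hG (k + 1) ?_
  rw [hS.factor, Matrix.det_mul, Matrix.det_mul, Matrix.det_diagonal,
    Finset.prod_eq_zero (Finset.mem_univ (Fin.last k)) (by simpa using h0)]
  ring

/-- `P_{1,k}` is orthogonal to all polynomials of smaller degree. -/
theorem bil_left_eq_zero (hS : IsLU G S₁ S₂ h) {k : ℕ} {g : ℝ[X]} (hg : g.degree < k) :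
    bil G (monicPoly S₁ k) g = 0 := by
  obtain ⟨c, rfl⟩ := hS.lower₂.exists_eq_sum k hg
  rw [map_sum]
  refine Finset.sum_eq_zero fun m hm => ?_
  rw [map_smul, hS.bil_monicPoly, if_neg (Finset.mem_range.mp hm).ne', smul_zero]

/-- `P_{2,k}` is orthogonal to all polynomials of smaller degree. -/
theorem bil_right_eq_zero (hS : IsLU G S₁ S₂ h) {k : ℕ} {g : ℝ[X]} (hg : g.degree < k) :
    bil G g (monicPoly S₂ k) = 0 := by
  rw [← bil_transpose]
  exact hS.transpose.bil_left_eq_zero hg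

theorem bil_left_monic (hS : IsLU G S₁ S₂ h) {k : ℕ} {g : ℝ[X]} (hg : g.Monic)
    (hgk : g.degree = k) : bil G (monicPoly S₁ k) g = h k := by
  have h1 := hS.bil_left_eq_zero (degree_sub_lt_of_monic hg (hS.lower₂.monic_monicPoly k) hgk
    (hS.lower₂.degree_monicPoly k))
  rw [map_sub, hS.bil_monicPoly, if_pos rfl, sub_eq_zero] at h1
  exact h1

theorem eq_sum (hS : IsLU G S₁ S₂ h) (hG : LUFactorizable G) {k : ℕ} {p : ℝ[X]}
    (hp : p.degree < k) :
    p = ∑ m ∈ Finset.range k, (bil G p (monicPoly S₂ m) / h m) • monicPoly S₁ m := by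
  obtain ⟨c, hc⟩ := hS.lower₁.exists_eq_sum k hp
  conv_lhs => rw [hc]
  refine Finset.sum_congr rfl fun m hm => ?_
  congr 1
  rw [hc, map_sum, LinearMap.sum_apply, Finset.sum_eq_single m]
  · rw [map_smul, LinearMap.smul_apply, hS.bil_monicPoly, if_pos rfl, smul_eq_mul,
      mul_div_cancel_right₀ _ (hS.ne_zero hG m)]
  · intro j _ hj
    rw [map_smul, LinearMap.smul_apply, hS.bil_monicPoly, if_neg hj, smul_zero]
  · exact fun h => absurd hm h

/-- Nondegeneracy of the form on polynomials of degree less than k. For the transformed form it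
gives all the invertibility statements about `blockR` and `PiR`. -/
theorem eq_zero_of_bil_X_pow (hS : IsLU G S₁ S₂ h) (hG : LUFactorizable G) {k : ℕ} {p : ℝ[X]}
    (hp : p.degree < k) (h0 : ∀ a < k, bil G p (X ^ a) = 0) : p = 0 := by
  rw [hS.eq_sum hG hp]
  refine Finset.sum_eq_zero fun m hm => ?_
  rw [bil_eq_zero_of_X_pow h0 (by
    rw [hS.lower₂.degree_monicPoly]; exact Nat.cast_lt.mpr (Finset.mem_range.mp hm)),
    zero_div, zero_smul]

end IsLU

theorem degree_sum_smul_monicPoly_lt {S : Matrix ℕ ℕ ℝ} (hS : IsLowerUnitriangular S) {l : ℕ}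
    (v : Fin l → ℝ) (n : ℕ) : (∑ a, v a • monicPoly S (n + a)).degree < (n + l : ℕ) := by
  refine (degree_sum_le _ _).trans_lt ((Finset.sup_lt_iff (WithBot.bot_lt_coe _)).mpr ?_)
  intro b _
  refine (degree_smul_le _ _).trans_lt ?_
  rw [hS.degree_monicPoly]
  exact Nat.cast_lt.mpr (by omega)

/-- The Christoffel–Darboux kernel `K^{[k]}(x, ·)` as a polynomial. -/
noncomputable def cdPoly (S₁ S₂ : Matrix ℕ ℕ ℝ) (h : ℕ → ℝ) (k : ℕ) (x : ℝ) : ℝ[X] :=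
  ∑ m ∈ Finset.range k, ((monicPoly S₂ m).eval x * (h m)⁻¹) • monicPoly S₁ m

section CdPoly

variable {G S₁ S₂ : Matrix ℕ ℕ ℝ} {h : ℕ → ℝ}

theorem eval_cdPoly (k : ℕ) (x y : ℝ) :
    (cdPoly S₁ S₂ h k x).eval y = cdKernel S₁ S₂ h k x y := by
  simp [cdPoly, cdKernel, eval_finsetSum]

theorem IsLU.degree_cdPoly_lt (hS : IsLU G S₁ S₂ h) (k : ℕ) (x : ℝ) :
    (cdPoly S₁ S₂ h k x).degree < k := by
  rw [cdPoly, Finset.sum_range]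
  simpa using degree_sum_smul_monicPoly_lt hS.lower₁ (l := k)
    (fun m => (monicPoly S₂ m).eval x * (h m)⁻¹) 0

theorem IsLU.bil_cdPoly_monicPoly (hS : IsLU G S₁ S₂ h) (hG : LUFactorizable G) {k m : ℕ}
    (hm : m < k) (x : ℝ) : bil G (cdPoly S₁ S₂ h k x) (monicPoly S₂ m) =
      (monicPoly S₂ m).eval x := by
  rw [cdPoly, map_sum, LinearMap.sum_apply, Finset.sum_eq_single m]
  · rw [map_smul, LinearMap.smul_apply, hS.bil_monicPoly, if_pos rfl, smul_eq_mul, mul_assoc,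
      inv_mul_cancel₀ (hS.ne_zero hG m), mul_one]
  · intro j _ hj
    rw [map_smul, LinearMap.smul_apply, hS.bil_monicPoly, if_neg hj, smul_zero]
  · exact fun h => absurd (Finset.mem_range.mpr hm) h

/-- The reproducing property of the Christoffel–Darboux kernel. -/
theorem IsLU.bil_cdPoly (hS : IsLU G S₁ S₂ h) (hG : LUFactorizable G) {k : ℕ} {g : ℝ[X]}
    (hg : g.degree < k) (x : ℝ) : bil G (cdPoly S₁ S₂ h k x) g = g.eval x := by
  obtain ⟨c, rfl⟩ := hS.lower₂.exists_eq_sum k hg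
  rw [map_sum, eval_finsetSum]
  refine Finset.sum_congr rfl fun m hm => ?_
  rw [map_smul, hS.bil_cdPoly_monicPoly hG (Finset.mem_range.mp hm), eval_smul]

end CdPoly

theorem quasiDet_of_vecMul_eq {k : ℕ} {A : Matrix (Fin k) (Fin k) ℝ} (hA : IsUnit A.det)
    {b c w : Fin k → ℝ} (hw : w ᵥ* A = c) (d : ℝ) : quasiDet A b c d = d - w ⬝ᵥ b := by
  rw [quasiDet, ← hw, Matrix.dotProduct_mulVec, Matrix.vecMul_vecMul,
    Matrix.mul_nonsing_inv _ hA, Matrix.vecMul_one]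

/-! ### Transformation of the bi-orthogonal polynomials -/

/-- The row `-((p, x^a))_{a < N} D`. -/
noncomputable def momentRow {N : ℕ} (G : Matrix ℕ ℕ ℝ) (D : Matrix (Fin N) (Fin N) ℝ) :
    ℝ[X] →ₗ[ℝ] (Fin N → ℝ) where
  toFun p := -((fun a : Fin N => bil G p (X ^ (a : ℕ))) ᵥ* D)
  map_add' p q := by
    rw [← neg_add, ← Matrix.add_vecMul]
    simp only [map_add, LinearMap.add_apply]
    rfl
  map_smul' r p := by
    rw [RingHom.id_apply, smul_neg, ← Matrix.smul_vecMul]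
    simp only [map_smul, LinearMap.smul_apply]
    rfl

section Transformation

variable {G R S₁ S₂ T₁ T₂ : Matrix ℕ ℕ ℝ} {h t : ℕ → ℝ} {N : ℕ} {D : Matrix (Fin N) (Fin N) ℝ}

theorem momentRow_apply (p : ℝ[X]) :
    momentRow R D p = -((fun a : Fin N => bil R p (X ^ (a : ℕ))) ᵥ* D) := rfl

theorem momentRow_eq_zero_iff (hD : IsUnit D.det) {p : ℝ[X]} :
    momentRow R D p = 0 ↔ ∀ a < N, bil R p (X ^ a) = 0 := by
  rw [momentRow_apply, neg_eq_zero]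
  refine ⟨fun h0 a ha => ?_, fun h0 => ?_⟩
  · have h1 := congrArg (fun v => v ᵥ* D⁻¹) h0
    simp only [Matrix.vecMul_vecMul, Matrix.mul_nonsing_inv _ hD, Matrix.vecMul_one,
      Matrix.zero_vecMul] at h1
    exact congrFun h1 ⟨a, ha⟩
  · have : (fun a : Fin N => bil R p (X ^ (a : ℕ))) = 0 := funext fun a => h0 a a.isLt
    rw [this, Matrix.zero_vecMul]

theorem vecMul_of_linearMap {k : ℕ} (B : ℝ[X] →ₗ[ℝ] (Fin k → ℝ)) (p : Fin k → ℝ[X])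
    (v : Fin k → ℝ) : v ᵥ* (Matrix.of fun a => B (p a)) = B (∑ a, v a • p a) := by
  ext b
  rw [map_sum, Finset.sum_apply]
  simp [Matrix.vecMul, dotProduct]

theorem degree_mul_lt {Q g : ℝ[X]} {m n : ℕ} (hQN : Q.degree = N) (hg : g.degree = m)
    (hmn : m < n) : (Q * g).degree < (n + N : ℕ) := by
  rw [degree_mul, hQN, hg, ← Nat.cast_add]
  exact Nat.cast_lt.mpr (by omega)

/-- Of the n + N Fourier coefficients the first n vanish, leaving as many unknowns as `momentRow`
gives equations. -/
theorem IsLU.eq_sum_tail (hS : IsLU G S₁ S₂ h) (hG : LUFactorizable G) {n : ℕ} {p : ℝ[X]}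
    (hp : p.degree < (n + N : ℕ)) (h0 : ∀ m < n, bil G p (monicPoly S₂ m) = 0) :
    p = ∑ a : Fin N, (bil G p (monicPoly S₂ (n + a)) / h (n + a)) • monicPoly S₁ (n + a) := by
  conv_lhs => rw [hS.eq_sum hG hp]
  rw [Finset.sum_range_add, Finset.sum_eq_zero, zero_add, Finset.sum_range]
  intro m hm
  rw [h0 m (Finset.mem_range.mp hm), zero_div, zero_smul]

theorem IsLU.sum_smul_monicPoly_eq_zero (hS : IsLU G S₁ S₂ h) (hG : LUFactorizable G) {k n : ℕ}
    {v : Fin k → ℝ} (hv : ∑ a, v a • monicPoly S₁ (n + a) = 0) : v = 0 := by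
  ext a
  have h1 := congrArg (fun p => bil G p (monicPoly S₂ (n + a))) hv
  simp only [map_sum, LinearMap.sum_apply, map_zero, LinearMap.zero_apply, map_smul,
    LinearMap.smul_apply, hS.bil_monicPoly] at h1
  rw [Finset.sum_eq_single a] at h1
  · simpa [hS.ne_zero hG] using h1
  · intro b _ hb
    rw [if_neg (by simpa [Fin.val_inj] using hb), smul_zero]
  · simp

/-- A left kernel vector yields a combination p of P_{1,n}, …, P_{1,n+N-1} that is R-orthogonal to
x^a for a < N. Being orthogonal to x^b for b < n in the original form, p is R-orthogonal to Q x^b as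
well. By degree induction it is R-orthogonal to every power below n + N, hence zero. -/
theorem isUnit_det_momentRow (hS : IsLU G S₁ S₂ h) (hG : LUFactorizable G) (hT : IsLU R T₁ T₂ t)
    (hR : LUFactorizable R) {Q : ℝ[X]} (hQ : Q.Monic) (hQN : Q.degree = N)
    (hGR : ∀ p g, bil R p (Q * g) = bil G p g) (hD : IsUnit D.det) (n : ℕ) :
    IsUnit (Matrix.of fun a : Fin N => momentRow R D (monicPoly S₁ (n + a))).det := by
  refine isUnit_det_of_vecMul_eq_zero fun v hv => ?_
  rw [vecMul_of_linearMap _ fun a : Fin N => monicPoly S₁ (n + a)] at hv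
  refine hS.sum_smul_monicPoly_eq_zero hG (hT.eq_zero_of_bil_X_pow hR
    (degree_sum_smul_monicPoly_lt hS.lower₁ v n) fun a ha => ?_)
  rw [momentRow_eq_zero_iff hD] at hv
  induction a using Nat.strong_induction_on with
  | _ a ih =>
    rcases lt_or_ge a N with haN | haN
    · exact hv a haN
    obtain ⟨b, rfl⟩ := Nat.exists_eq_add_of_le haN
    have hdeg : (Q * X ^ b : ℝ[X]).degree = ((N + b : ℕ) : WithBot ℕ) := by
      rw [degree_mul, hQN, degree_X_pow, ← Nat.cast_add]
    -- Modulo lower powers, already treated, x^{N+b} may be replaced by Q x^b.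
    have h1 := degree_sub_lt_of_monic (monic_X_pow (N + b)) (hQ.mul (monic_X_pow b))
      (degree_X_pow _) hdeg
    have h2 := bil_eq_zero_of_X_pow (fun c hc => ih c hc (by omega)) h1
    rw [map_sub, sub_eq_zero] at h2
    rw [h2, hGR, map_sum, LinearMap.sum_apply]
    refine Finset.sum_eq_zero fun c _ => ?_
    rw [map_smul, LinearMap.smul_apply, hS.bil_left_eq_zero, smul_zero]
    rw [degree_X_pow]
    exact Nat.cast_lt.mpr (by omega)

/-- The coefficient at P_{1,m} is ⟨Ť, Q P_{2,m}⟩_R / h_m with Ť = `monicPoly T₁ (n + N)`. It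
vanishes for m < n by degree; at m = n the second argument is monic of degree n + N, which produces
the ratio t/h. -/
theorem exists_monicPoly_eq_add_sum (hS : IsLU G S₁ S₂ h) (hG : LUFactorizable G)
    (hT : IsLU R T₁ T₂ t) {Q : ℝ[X]} (hQ : Q.Monic) (hQN : Q.degree = N)
    (hGR : ∀ p g, bil R p (Q * g) = bil G p g) (hN : 0 < N) (n : ℕ) :
    ∃ w : Fin N → ℝ, w ⟨0, hN⟩ = t (n + N) / h n ∧ monicPoly T₁ (n + N) =
      monicPoly S₁ (n + N) + ∑ a, w a • monicPoly S₁ (n + a) := by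
  have hd : (monicPoly T₁ (n + N) - monicPoly S₁ (n + N)).degree < (n + N : ℕ) :=
    degree_sub_lt_of_monic (hT.lower₁.monic_monicPoly _) (hS.lower₁.monic_monicPoly _)
      (hT.lower₁.degree_monicPoly _) (hS.lower₁.degree_monicPoly _)
  have hb : ∀ m < n + N, bil G (monicPoly T₁ (n + N) - monicPoly S₁ (n + N)) (monicPoly S₂ m) =
      bil R (monicPoly T₁ (n + N)) (Q * monicPoly S₂ m) := fun m hm => by
    rw [map_sub, LinearMap.sub_apply, hS.bil_monicPoly, if_neg (by omega), sub_zero, hGR]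
  refine ⟨fun a => bil G (monicPoly T₁ (n + N) - monicPoly S₁ (n + N)) (monicPoly S₂ (n + a)) /
    h (n + a), ?_, ?_⟩
  · simp only [add_zero]
    rw [hb n (by omega), hT.bil_left_monic (hQ.mul (hS.lower₂.monic_monicPoly n))]
    rw [degree_mul, hQN, hS.lower₂.degree_monicPoly, ← Nat.cast_add, add_comm]
  · rw [← sub_eq_iff_eq_add']
    refine hS.eq_sum_tail hG hd fun m hm => ?_
    rw [hb m (by omega)]
    exact hT.bil_left_eq_zero (degree_mul_lt hQN (hS.lower₂.degree_monicPoly m) hm)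

/-- The N unknown coefficients solve the linear system expressing that the moment row of the
transformed polynomial is zero. Pairing the solution with e₀ extracts t/h. -/
theorem monicPoly_transform_first (hS : IsLU G S₁ S₂ h) (hG : LUFactorizable G)
    (hT : IsLU R T₁ T₂ t) (hR : LUFactorizable R) {Q : ℝ[X]} (hQ : Q.Monic) (hQN : Q.degree = N)
    (hGR : ∀ p g, bil R p (Q * g) = bil G p g) (hD : IsUnit D.det) (hN : 0 < N) (n : ℕ) :
    (∀ x : ℝ, (monicPoly T₁ (n + N)).eval x =
      quasiDet (Matrix.of fun a : Fin N => momentRow R D (monicPoly S₁ (n + a)))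
        (fun a => (monicPoly S₁ (n + a)).eval x) (momentRow R D (monicPoly S₁ (n + N)))
        ((monicPoly S₁ (n + N)).eval x)) ∧
    t (n + N) = h n *
      quasiDet (Matrix.of fun a : Fin N => momentRow R D (monicPoly S₁ (n + a)))
        (firstUnit N) (momentRow R D (monicPoly S₁ (n + N))) 0 := by
  have hA := isUnit_det_momentRow hS hG hT hR hQ hQN hGR hD n
  obtain ⟨w, hw0, hw⟩ := exists_monicPoly_eq_add_sum hS hG hT hQ hQN hGR hN n
  have h0 : momentRow R D (monicPoly T₁ (n + N)) = 0 := by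
    rw [momentRow_eq_zero_iff hD]
    intro a ha
    refine hT.bil_left_eq_zero ?_
    rw [degree_X_pow]
    exact Nat.cast_lt.mpr (by omega)
  have hv : (-w) ᵥ* (Matrix.of fun a : Fin N => momentRow R D (monicPoly S₁ (n + a))) =
      momentRow R D (monicPoly S₁ (n + N)) := by
    rw [hw, map_add, add_eq_zero_iff_eq_neg] at h0
    rw [Matrix.neg_vecMul, vecMul_of_linearMap _ fun a : Fin N => monicPoly S₁ (n + a), h0]
  refine ⟨fun x => ?_, ?_⟩
  · rw [quasiDet_of_vecMul_eq hA hv, hw, eval_add, eval_finsetSum, neg_dotProduct, sub_neg_eq_add]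
    simp [dotProduct]
  · rw [quasiDet_of_vecMul_eq hA hv, neg_dotProduct, sub_neg_eq_add, zero_add, dotProduct,
      Finset.sum_eq_single ⟨0, hN⟩, hw0]
    · have := hS.ne_zero hG n
      simp only [firstUnit, if_true]
      field_simp
    · intro b _ hb
      rw [firstUnit, if_neg (fun hb' => hb (Fin.ext hb')), mul_zero]
    · simp

/-- Both kernels reproduce, so Q(x) K(x, ·) minus the transformed kernel has no component along
P_{1,m} for m < n. Its moment row is the known kernel row, and its component at m = n is the wanted
value divided by h_n. -/
theorem monicPoly_transform_second (hS : IsLU G S₁ S₂ h) (hG : LUFactorizable G)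
    (hT : IsLU R T₁ T₂ t) (hR : LUFactorizable R) {Q : ℝ[X]} (hQ : Q.Monic) (hQN : Q.degree = N)
    (hGR : ∀ p g, bil R p (Q * g) = bil G p g) (hD : IsUnit D.det) (hN : 0 < N) (n : ℕ) (x : ℝ) :
    (monicPoly T₂ (n + N)).eval x = -h n *
      quasiDet (Matrix.of fun a : Fin N => momentRow R D (monicPoly S₁ (n + a)))
        (firstUnit N) (Q.eval x • momentRow R D (cdPoly S₁ S₂ h (n + N) x) +
          (fun a : Fin N => x ^ (a : ℕ)) ᵥ* D) 0 := by
  have hA := isUnit_det_momentRow hS hG hT hR hQ hQN hGR hD n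
  set p := Q.eval x • cdPoly S₁ S₂ h (n + N) x - cdPoly T₁ T₂ t (n + N) x with hp
  have hpd : p.degree < (n + N : ℕ) :=
    (degree_sub_le _ _).trans_lt (max_lt ((degree_smul_le _ _).trans_lt
      (hS.degree_cdPoly_lt _ _)) (hT.degree_cdPoly_lt _ _))
  have hpm : ∀ m < n + N, bil G p (monicPoly S₂ m) = Q.eval x * (monicPoly S₂ m).eval x -
      bil R (cdPoly T₁ T₂ t (n + N) x) (Q * monicPoly S₂ m) := fun m hm => by
    rw [hp, map_sub, LinearMap.sub_apply, map_smul, LinearMap.smul_apply,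
      hS.bil_cdPoly_monicPoly hG hm, smul_eq_mul, hGR]
  have hrow : momentRow R D p = Q.eval x • momentRow R D (cdPoly S₁ S₂ h (n + N) x) +
      (fun a : Fin N => x ^ (a : ℕ)) ᵥ* D := by
    rw [hp, map_sub, map_smul, sub_eq_add_neg, add_right_inj, momentRow_apply (cdPoly T₁ T₂ t _ _),
      neg_neg]
    congr 1
    ext a
    rw [hT.bil_cdPoly hR, eval_pow, eval_X]
    rw [degree_X_pow]
    exact Nat.cast_lt.mpr (by omega)
  have htail := hS.eq_sum_tail hG hpd fun m hm => by
    rw [hpm m (by omega), hT.bil_cdPoly hR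
      (degree_mul_lt hQN (hS.lower₂.degree_monicPoly m) hm), eval_mul, sub_self]
  have hw := vecMul_of_linearMap (momentRow R D) (fun a : Fin N => monicPoly S₁ (n + a))
    fun a => bil G p (monicPoly S₂ (n + a)) / h (n + a)
  rw [← htail, hrow] at hw
  rw [quasiDet_of_vecMul_eq hA hw, dotProduct, Finset.sum_eq_single ⟨0, hN⟩]
  · have hn := hS.ne_zero hG n
    simp only [firstUnit, if_true, add_zero]
    have hmon := hQ.mul (hS.lower₂.monic_monicPoly n)
    have hdeg : (Q * monicPoly S₂ n).degree = (n + N : ℕ) := by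
      rw [degree_mul, hQN, hS.lower₂.degree_monicPoly, ← Nat.cast_add, add_comm]
    -- The transformed kernel fails to reproduce Q P_{2,n}, of degree exactly n + N. It does
    -- reproduce Q P_{2,n} minus the transformed monic polynomial, to which it is itself orthogonal.
    have h1 := hT.bil_cdPoly hR (degree_sub_lt_of_monic hmon (hT.lower₂.monic_monicPoly (n + N))
      hdeg (hT.lower₂.degree_monicPoly _)) x
    rw [map_sub, hT.bil_right_eq_zero (hT.degree_cdPoly_lt _ _), sub_zero, eval_sub,
      eval_mul] at h1
    rw [hpm n (by omega), h1]
    field_simp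
    ring
  · intro b _ hb
    rw [firstUnit, if_neg (fun hb' => hb (Fin.ext hb')), mul_zero]
  · simp

/-- The formulas for the polynomials of degree less than `N`, in terms of a matrix with entries
`-(P_{1,m}, x^a)`. -/
theorem monicPoly_transform_small (hS : IsLU G S₁ S₂ h) (hG : LUFactorizable G)
    (hT : IsLU R T₁ T₂ t) (hR : LUFactorizable R) {M : Matrix (Fin N) (Fin N) ℝ}
    (hM : ∀ m a, M m a = -bil R (monicPoly S₁ m) (X ^ (a : ℕ))) (k : Fin N) :
    IsUnit (leadingBlock M k).det ∧
    (∀ x : ℝ, (monicPoly T₁ k).eval x =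
      borderedQuasiDet M k (fun a => (monicPoly S₁ a).eval x) ((monicPoly S₁ k).eval x)) ∧
    (∀ x : ℝ, (monicPoly T₂ k).eval x =
      borderedQuasiDet Mᵀ k (fun a => x ^ (a : ℕ)) (x ^ (k : ℕ))) ∧
    t k = -borderedQuasiDet M k (fun a => M (Fin.castLE k.isLt.le a) k) (M k k) := by
  have hLB : ∀ a b, leadingBlock M k a b = -bil R (monicPoly S₁ a) (X ^ (b : ℕ)) := fun a b => by
    rw [leadingBlock, Matrix.submatrix_apply, hM]
    rfl
  have hvec : ∀ (v : Fin (k : ℕ) → ℝ) (b : Fin (k : ℕ)), (v ᵥ* leadingBlock M k) b =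
      -bil R (∑ a, v a • monicPoly S₁ a) (X ^ (b : ℕ)) := fun v b => by
    rw [map_sum, LinearMap.sum_apply, ← Finset.sum_neg_distrib, Matrix.vecMul, dotProduct]
    refine Finset.sum_congr rfl fun a _ => ?_
    rw [hLB, map_smul, LinearMap.smul_apply, smul_eq_mul, mul_neg]
  have hdet : IsUnit (leadingBlock M k).det := by
    refine isUnit_det_of_vecMul_eq_zero fun v hv => ?_
    have h0 : ∑ a, v a • monicPoly S₁ (0 + a) = 0 := by
      refine hT.eq_zero_of_bil_X_pow hR (k := k) (by
        simpa using degree_sum_smul_monicPoly_lt hS.lower₁ v 0) fun b hb => ?_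
      have := congrFun hv ⟨b, hb⟩
      rw [hvec, Pi.zero_apply, neg_eq_zero] at this
      simpa using this
    exact hS.sum_smul_monicPoly_eq_zero hG h0
  obtain ⟨c, hc⟩ := hS.lower₁.exists_eq_sum k (degree_sub_lt_of_monic
    (hT.lower₁.monic_monicPoly k) (hS.lower₁.monic_monicPoly k)
    (hT.lower₁.degree_monicPoly k) (hS.lower₁.degree_monicPoly k))
  rw [Finset.sum_range, sub_eq_iff_eq_add] at hc
  have horth : ∀ b : ℕ, b < k → bil R (monicPoly T₁ k) (X ^ b) = 0 := fun b hb =>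
    hT.bil_left_eq_zero (by rw [degree_X_pow]; exact Nat.cast_lt.mpr hb)
  have hrow : (-fun a : Fin (k : ℕ) => c a) ᵥ* leadingBlock M k =
      fun j => M k (Fin.castLE k.isLt.le j) := by
    ext b
    have h1 := horth b b.isLt
    rw [hc, map_add, LinearMap.add_apply, add_eq_zero_iff_eq_neg] at h1
    rw [Matrix.neg_vecMul, Pi.neg_apply, hvec, neg_neg, h1, hM]
    rfl
  have hT₂ := hT.lower₂.monicPoly_eq k
  -- The transformed second polynomial is R-orthogonal on the left to each P_{1,b}, b < k. Expanded
  -- in powers of x, this is a system with the transposed leading block.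
  have hcol : (-fun a : Fin (k : ℕ) => T₂ k a) ᵥ* leadingBlock Mᵀ k =
      fun j => Mᵀ k (Fin.castLE k.isLt.le j) := by
    ext b
    have h1 := hT.bil_right_eq_zero (g := monicPoly S₁ b) (k := k) (by
      rw [hS.lower₁.degree_monicPoly]; exact Nat.cast_lt.mpr b.isLt)
    rw [hT₂, map_add, add_eq_zero_iff_eq_neg, map_sum] at h1
    rw [Matrix.neg_vecMul, Pi.neg_apply, Matrix.transpose_apply, hM, Matrix.vecMul, dotProduct]
    rw [← Finset.sum_neg_distrib]
    change _ = -bil R (monicPoly S₁ b) (X ^ (k : ℕ))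
    rw [h1, neg_neg]
    refine Finset.sum_congr rfl fun a _ => ?_
    have h2 : leadingBlock Mᵀ k a b = leadingBlock M k b a := rfl
    rw [h2, hLB, map_smul, smul_eq_mul]
    ring
  have hdetT : IsUnit (leadingBlock Mᵀ k).det := by
    have : leadingBlock Mᵀ k = (leadingBlock M k)ᵀ := rfl
    rwa [this, Matrix.det_transpose]
  refine ⟨hdet, fun x => ?_, fun x => ?_, ?_⟩
  · rw [borderedQuasiDet, quasiDet_of_vecMul_eq hdet hrow, hc, neg_dotProduct, sub_neg_eq_add,
      eval_add, eval_finsetSum, add_comm]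
    simp [dotProduct]
  · rw [borderedQuasiDet, quasiDet_of_vecMul_eq hdetT hcol, hT₂, neg_dotProduct, sub_neg_eq_add,
      eval_add, eval_finsetSum]
    simp [dotProduct]
  -- Since x^k is monic, t k equals the pairing of the transformed first polynomial with x^k; the
  -- outer sign is that of the entries of M.
  · rw [borderedQuasiDet, quasiDet_of_vecMul_eq hdet hrow, neg_dotProduct, sub_neg_eq_add,
      ← hT.bil_left_monic (monic_X_pow (k : ℕ)) (degree_X_pow _), hc, map_add,
      LinearMap.add_apply, map_sum, LinearMap.sum_apply, hM, neg_add, neg_neg, add_comm, dotProduct,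
      ← Finset.sum_neg_distrib]
    congr 1
    refine Finset.sum_congr rfl fun a _ => ?_
    rw [hM, map_smul, LinearMap.smul_apply, smul_eq_mul, mul_neg, neg_neg]
    rfl

end Transformation

/-! ### The right transformation -/

theorem GeronimusData.germ_congr (Γ : GeronimusData) {f g : ℝ → ℝ}
    (h : ∀ i, f =ᶠ[nhds (Γ.q i)] g) : Γ.germ f = Γ.germ g := by
  ext c
  rw [germ, germ, (h _).iteratedDeriv_eq]

theorem GeronimusData.N_pos {Γ : GeronimusData} (hs : 0 < Γ.s) (hn : ∀ i, 0 < Γ.n i) : 0 < Γ.N :=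
  (hn ⟨0, hs⟩).trans_le (Finset.single_le_sum (f := Γ.n) (fun _ _ => Nat.zero_le _)
    (Finset.mem_univ _))

namespace MeasureMatrix

variable {W : MeasureMatrix} {Γ : GeronimusData}

theorem HasFiniteMoments.rowR_eq (hW : W.HasFiniteMoments) (hΩ : ∀ i, Γ.q i ∉ W.Omega)
    (S₁ : Matrix ℕ ℕ ℝ) (m : ℕ) : W.rowR Γ S₁ m =
      momentRow (W.geronimusR Γ).moment (Γ.Qmat * Γ.germChi) (monicPoly S₁ m) :=
  hW.germDiff_XiR hΩ _

theorem HasFiniteMoments.kernelRowR_eq (hW : W.HasFiniteMoments) (hΩ : ∀ i, Γ.q i ∉ W.Omega)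
    (S₁ S₂ : Matrix ℕ ℕ ℝ) (h : ℕ → ℝ) (k : ℕ) (x : ℝ) : W.kernelRowR Γ S₁ S₂ h k x =
      Γ.Q.eval x • momentRow (W.geronimusR Γ).moment (Γ.Qmat * Γ.germChi)
        (cdPoly S₁ S₂ h k x) + (fun a : Fin Γ.N => x ^ (a : ℕ)) ᵥ* (Γ.Qmat * Γ.germChi) := by
  rw [kernelRowR, momentRow_apply, ← hW.germDiff_XiR hΩ]
  congr 2
  simp only [eval_cdPoly, GeronimusData.germDiff]
  congr 1
  -- The mixed kernel is the second kind function of the kernel polynomial only off Ω, where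
  -- linearity is available; germs at the q_i need no more.
  refine Γ.germ_congr fun i => ?_
  filter_upwards [W.isClosed_Omega.isOpen_compl.mem_nhds (hΩ i)] with y hy
  rw [mixedKernel₂]
  simp only [← eval_cdPoly]
  exact ((hW.admissible_one_div hy).form_sum _ _ _).symm

/-- Every row of `blockR` is a moment row, hence carries the factor 𝐐 Π_q[χ^{[N]}] on the right;
inverting that factor leaves the bare moments. -/
theorem HasFiniteMoments.PiR_apply (hW : W.HasFiniteMoments) (hΩ : ∀ i, Γ.q i ∉ W.Omega)
    (hq : Function.Injective Γ.q) (S₁ : Matrix ℕ ℕ ℝ) (m a : Fin Γ.N) : W.PiR Γ S₁ m a =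
      -bil (W.geronimusR Γ).moment (monicPoly S₁ m) (X ^ (a : ℕ)) := by
  have h : W.blockR Γ S₁ 0 = (Matrix.of fun m a : Fin Γ.N =>
      -bil (W.geronimusR Γ).moment (monicPoly S₁ m) (X ^ (a : ℕ))) *
        (Γ.Qmat * Γ.germChi) := by
    ext m c
    rw [blockR, Matrix.of_apply, hW.rowR_eq hΩ, momentRow_apply, zero_add, ← Matrix.neg_vecMul]
    rfl
  rw [PiR, h, Matrix.mul_assoc,
    Matrix.mul_nonsing_inv _ (GeronimusData.isUnit_det_Qmat_mul_germChi hq), Matrix.mul_one,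
    Matrix.of_apply]

/-- The formulas for the right transformation. -/
theorem geronimusR_formulas (hW : W.HasFiniteMoments)
    (hG : LUFactorizable W.moment)
    {S₁ S₂ : Matrix ℕ ℕ ℝ} {h : ℕ → ℝ} (hS : IsLU W.moment S₁ S₂ h)
    (hs : 0 < Γ.s) (hq : Function.Injective Γ.q) (hn : ∀ i, 0 < Γ.n i)
    (hΩ : ∀ i, Γ.q i ∉ W.Omega) (hR : LUFactorizable (W.geronimusR Γ).moment)
    {T₁ T₂ : Matrix ℕ ℕ ℝ} {t : ℕ → ℝ} (hT : IsLU (W.geronimusR Γ).moment T₁ T₂ t) :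
    (∀ k : ℕ, Γ.N ≤ k →
      IsUnit (W.blockR Γ S₁ (k - Γ.N)).det ∧
      (∀ x : ℝ, (monicPoly T₁ k).eval x =
        quasiDet (W.blockR Γ S₁ (k - Γ.N))
          (fun a => (monicPoly S₁ (k - Γ.N + a)).eval x)
          (W.rowR Γ S₁ k) ((monicPoly S₁ k).eval x)) ∧
      (∀ x : ℝ, (monicPoly T₂ k).eval x =
        -h (k - Γ.N) * quasiDet (W.blockR Γ S₁ (k - Γ.N)) (firstUnit Γ.N)
          (W.kernelRowR Γ S₁ S₂ h k x) 0) ∧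
      t k = h (k - Γ.N) *
        quasiDet (W.blockR Γ S₁ (k - Γ.N)) (firstUnit Γ.N) (W.rowR Γ S₁ k) 0) ∧
    (∀ k : Fin Γ.N,
      IsUnit (leadingBlock (W.PiR Γ S₁) k).det ∧
      (∀ x : ℝ, (monicPoly T₁ k).eval x =
        borderedQuasiDet (W.PiR Γ S₁) k (fun a => (monicPoly S₁ a).eval x)
          ((monicPoly S₁ k).eval x)) ∧
      (∀ x : ℝ, (monicPoly T₂ k).eval x =
        borderedQuasiDet (W.PiR Γ S₁)ᵀ k (fun a => x ^ (a : ℕ)) (x ^ (k : ℕ))) ∧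
      t k = -borderedQuasiDet (W.PiR Γ S₁) k
        (fun a => W.PiR Γ S₁ (Fin.castLE k.isLt.le a) k) (W.PiR Γ S₁ k k)) := by
  have hN := GeronimusData.N_pos hs hn
  have hD := GeronimusData.isUnit_det_Qmat_mul_germChi hq
  have hQN : Γ.Q.degree = Γ.N := by
    rw [degree_eq_natDegree Γ.Q_monic.ne_zero, Γ.Q_natDegree]
  have hGR := hW.bil_geronimusR_Q_mul hΩ
  refine ⟨fun k hk => ?_, fun k => monicPoly_transform_small hS hG hT hR
    (hW.PiR_apply hΩ hq S₁) k⟩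
  obtain ⟨n, rfl⟩ := Nat.exists_eq_add_of_le' hk
  have hb : W.blockR Γ S₁ n = Matrix.of fun a : Fin Γ.N => momentRow (W.geronimusR Γ).moment
      (Γ.Qmat * Γ.germChi) (monicPoly S₁ (n + a)) := by
    rw [blockR]
    simp only [hW.rowR_eq hΩ]
  obtain ⟨h1, h2⟩ := monicPoly_transform_first hS hG hT hR Γ.Q_monic hQN hGR hD hN n
  rw [Nat.add_sub_cancel, hb, hW.rowR_eq hΩ]
  refine ⟨isUnit_det_momentRow hS hG hT hR Γ.Q_monic hQN hGR hD n, h1, fun x => ?_, h2⟩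
  rw [hW.kernelRowR_eq hΩ]
  exact monicPoly_transform_second hS hG hT hR Γ.Q_monic hQN hGR hD hN n x

/-! ### The left transformation as a right transformation -/

/-- The transposed measure matrix. -/
def transpose (W : MeasureMatrix) : MeasureMatrix where
  order := W.order
  entry a b := W.entry b a
  entry_eq_zero a b h := W.entry_eq_zero b a h.symm

theorem form_transpose (W : MeasureMatrix) (f g : ℝ → ℝ) :
    W.transpose.form f g = W.form g f := by
  simp only [form, transpose]
  rw [Finset.sum_comm]
  simp only [mul_comm]

theorem moment_transpose (W : MeasureMatrix) : W.transpose.moment = W.momentᵀ := by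
  ext i j
  exact W.form_transpose _ _

theorem Omega_transpose (W : MeasureMatrix) : W.transpose.Omega = W.Omega := by
  simp only [Omega, transpose]
  exact Set.iUnion_comm _

end MeasureMatrix

/-- The data with transposed matrices of free parameters. -/
def GeronimusData.transpose (Γ : GeronimusData) : GeronimusData where
  s := Γ.s
  q := Γ.q
  n := Γ.n
  ξ i := (Γ.ξ i)ᵀ

namespace MeasureMatrix

variable (W : MeasureMatrix) (Γ : GeronimusData)

theorem massEntry_transpose (a b : ℕ) : Γ.transpose.massEntry a b = Γ.massEntry b a := by
  simp only [GeronimusData.massEntry]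
  refine Finset.sum_congr rfl fun i _ => ?_
  simp only [GeronimusData.transpose, Matrix.transpose_apply, mul_comm (a.factorial : ℝ),
    and_comm (a := a < Γ.n i)]

/-- Transposing W [Q(𝒳ᵀ)]⁻¹ puts [Q(𝒳)]⁻¹ on the left, since polynomials and inverses commute with
transposition; the matrices of masses are transposed too. -/
theorem geronimusR_transpose :
    W.transpose.geronimusR Γ.transpose = (W.geronimusL Γ).transpose := by
  have h : (W.transpose.geronimusR Γ.transpose).entry = (W.geronimusL Γ).transpose.entry := by
    ext1 a
    ext1 b
    change _ + _ = _ + _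
    rw [massEntry_transpose]
    congr 1
    by_cases hb : b < W.order + 1
    · rw [dif_pos (show b < W.transpose.order + 1 from hb), dif_pos hb]
      refine Finset.sum_congr rfl fun m _ => ?_
      congr 1
      ext x
      have e : aeval (mulX W.order x)ᵀ Γ.Q = (aeval (mulX W.order x) Γ.Q)ᵀ := by
        simp only [aeval_eq_sum_range, Matrix.transpose_sum, Matrix.transpose_smul,
          Matrix.transpose_pow]
      change (aeval (mulX W.order x)ᵀ Γ.Q)⁻¹ m _ = _
      rw [e, ← Matrix.transpose_nonsing_inv]
      rfl
    · rw [dif_neg (show ¬ b < W.transpose.order + 1 from hb), dif_neg hb]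
  unfold geronimusR transpose geronimusL at *
  simp only [MeasureMatrix.mk.injEq]
  exact ⟨rfl, h⟩

theorem secondKind₁_transpose (S : Matrix ℕ ℕ ℝ) :
    W.transpose.secondKind₁ S = W.secondKind₂ S := by
  ext l y
  exact W.form_transpose _ _

/-- The transposed parameters turn Ξ_R into Ξ_L definitionally, so only the second kind functions
have to be rewritten. -/
theorem rowR_transpose (S : Matrix ℕ ℕ ℝ) (m : ℕ) :
    W.transpose.rowR Γ.transpose S m = W.rowL Γ S m := by
  rw [rowR, secondKind₁_transpose]
  rfl

theorem blockR_transpose (S : Matrix ℕ ℕ ℝ) (m : ℕ) :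
    W.transpose.blockR Γ.transpose S m = W.blockL Γ S m := by
  rw [blockR]
  simp only [rowR_transpose]
  rfl

theorem PiR_transpose (S : Matrix ℕ ℕ ℝ) :
    W.transpose.PiR Γ.transpose S = W.PiL Γ S := by
  rw [PiR, blockR_transpose]
  rfl

theorem kernelRowR_transpose (S₁ S₂ : Matrix ℕ ℕ ℝ) (h : ℕ → ℝ) (k : ℕ) (x : ℝ) :
    W.transpose.kernelRowR Γ.transpose S₂ S₁ h k x = W.kernelRowL Γ S₁ S₂ h k x := by
  have h1 : (fun y => mixedKernel₂ W.transpose S₂ S₁ h k x y) =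
      fun y => mixedKernel₁ W S₁ S₂ h k y x := by
    ext y
    rw [mixedKernel₂, mixedKernel₁]
    refine Finset.sum_congr rfl fun m _ => ?_
    rw [secondKind₁_transpose]
    ring
  have h2 : (fun y => cdKernel S₂ S₁ h k x y) = fun y => cdKernel S₁ S₂ h k y x := by
    ext y
    rw [cdKernel, cdKernel]
    refine Finset.sum_congr rfl fun m _ => ?_
    ring
  rw [kernelRowR, h1, h2]
  rfl

theorem HasFiniteMoments.transpose {W : MeasureMatrix} (hW : W.HasFiniteMoments) :
    W.transpose.HasFiniteMoments := fun a b k => hW b a k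

end MeasureMatrix

theorem LUFactorizable.transpose {G : Matrix ℕ ℕ ℝ} (hG : LUFactorizable G) :
    LUFactorizable Gᵀ := fun k => by
  have : trunc k Gᵀ = (trunc k G)ᵀ := rfl
  rw [this, Matrix.det_transpose]
  exact hG k

/-! ### The main theorem: both transformations -/

theorem mainTheorem3 (W : MeasureMatrix) (hW : W.HasFiniteMoments)
    (hG : LUFactorizable W.moment)
    (S₁ S₂ : Matrix ℕ ℕ ℝ) (h : ℕ → ℝ) (hS : IsLU W.moment S₁ S₂ h)
    (Γ : GeronimusData) (hs : 0 < Γ.s) (hq : Function.Injective Γ.q) (hn : ∀ i, 0 < Γ.n i)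
    (hΩ : ∀ i, Γ.q i ∉ W.Omega) :
    IsUnit (Γ.Qmat * Γ.germChi).det ∧
    -- right transformation
    ((W.geronimusR Γ).HasFiniteMoments ∧
      (LUFactorizable (W.geronimusR Γ).moment →
        ∀ (T₁ T₂ : Matrix ℕ ℕ ℝ) (t : ℕ → ℝ), IsLU (W.geronimusR Γ).moment T₁ T₂ t →
          (∀ k : ℕ, Γ.N ≤ k →
            IsUnit (W.blockR Γ S₁ (k - Γ.N)).det ∧
            (∀ x : ℝ, (monicPoly T₁ k).eval x =
              quasiDet (W.blockR Γ S₁ (k - Γ.N))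
                (fun a => (monicPoly S₁ (k - Γ.N + a)).eval x)
                (W.rowR Γ S₁ k) ((monicPoly S₁ k).eval x)) ∧
            (∀ x : ℝ, (monicPoly T₂ k).eval x =
              -h (k - Γ.N) * quasiDet (W.blockR Γ S₁ (k - Γ.N)) (firstUnit Γ.N)
                (W.kernelRowR Γ S₁ S₂ h k x) 0) ∧
            t k = h (k - Γ.N) *
              quasiDet (W.blockR Γ S₁ (k - Γ.N)) (firstUnit Γ.N) (W.rowR Γ S₁ k) 0) ∧
          (∀ k : Fin Γ.N,
            IsUnit (leadingBlock (W.PiR Γ S₁) k).det ∧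
            (∀ x : ℝ, (monicPoly T₁ k).eval x =
              borderedQuasiDet (W.PiR Γ S₁) k (fun a => (monicPoly S₁ a).eval x)
                ((monicPoly S₁ k).eval x)) ∧
            (∀ x : ℝ, (monicPoly T₂ k).eval x =
              borderedQuasiDet (W.PiR Γ S₁)ᵀ k (fun a => x ^ (a : ℕ)) (x ^ (k : ℕ))) ∧
            t k = -borderedQuasiDet (W.PiR Γ S₁) k
              (fun a => W.PiR Γ S₁ (Fin.castLE k.isLt.le a) k) (W.PiR Γ S₁ k k)))) ∧
    -- left transformation
    ((W.geronimusL Γ).HasFiniteMoments ∧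
      (LUFactorizable (W.geronimusL Γ).moment →
        ∀ (T₁ T₂ : Matrix ℕ ℕ ℝ) (t : ℕ → ℝ), IsLU (W.geronimusL Γ).moment T₁ T₂ t →
          (∀ k : ℕ, Γ.N ≤ k →
            IsUnit (W.blockL Γ S₂ (k - Γ.N)).det ∧
            (∀ x : ℝ, (monicPoly T₂ k).eval x =
              quasiDet (W.blockL Γ S₂ (k - Γ.N))
                (fun a => (monicPoly S₂ (k - Γ.N + a)).eval x)
                (W.rowL Γ S₂ k) ((monicPoly S₂ k).eval x)) ∧
            (∀ x : ℝ, (monicPoly T₁ k).eval x =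
              -h (k - Γ.N) * quasiDet (W.blockL Γ S₂ (k - Γ.N)) (firstUnit Γ.N)
                (W.kernelRowL Γ S₁ S₂ h k x) 0) ∧
            t k = h (k - Γ.N) *
              quasiDet (W.blockL Γ S₂ (k - Γ.N)) (firstUnit Γ.N) (W.rowL Γ S₂ k) 0) ∧
          (∀ k : Fin Γ.N,
            IsUnit (leadingBlock (W.PiL Γ S₂) k).det ∧
            (∀ x : ℝ, (monicPoly T₂ k).eval x =
              borderedQuasiDet (W.PiL Γ S₂) k (fun a => (monicPoly S₂ a).eval x)
                ((monicPoly S₂ k).eval x)) ∧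
            (∀ x : ℝ, (monicPoly T₁ k).eval x =
              borderedQuasiDet (W.PiL Γ S₂)ᵀ k (fun a => x ^ (a : ℕ)) (x ^ (k : ℕ))) ∧
            t k = -borderedQuasiDet (W.PiL Γ S₂) k
              (fun a => W.PiL Γ S₂ (Fin.castLE k.isLt.le a) k) (W.PiL Γ S₂ k k)))) := by
  refine ⟨GeronimusData.isUnit_det_Qmat_mul_germChi hq, ⟨hW.geronimusR hΩ,
    fun hR T₁ T₂ t hT => MeasureMatrix.geronimusR_formulas hW hG hS hs hq hn hΩ hR hT⟩, ?_⟩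
  have hΩ' : ∀ i, Γ.transpose.q i ∉ W.transpose.Omega := fun i => by
    rw [W.Omega_transpose]
    exact hΩ i
  have hG' : LUFactorizable W.transpose.moment := by
    rw [W.moment_transpose]
    exact hG.transpose
  have hS' : IsLU W.transpose.moment S₂ S₁ h := by
    rw [W.moment_transpose]
    exact hS.transpose
  have hfin := hW.transpose.geronimusR hΩ'
  rw [W.geronimusR_transpose Γ] at hfin
  refine ⟨hfin.transpose, fun hL T₁ T₂ t hT => ?_⟩
  have hR' : LUFactorizable (W.transpose.geronimusR Γ.transpose).moment := by
    rw [W.geronimusR_transpose, MeasureMatrix.moment_transpose]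
    exact hL.transpose
  have hT' : IsLU (W.transpose.geronimusR Γ.transpose).moment T₂ T₁ t := by
    rw [W.geronimusR_transpose, MeasureMatrix.moment_transpose]
    exact hT.transpose
  have key := MeasureMatrix.geronimusR_formulas (Γ := Γ.transpose) hW.transpose hG' hS' hs hq hn
    hΩ' hR' hT'
  simp only [W.blockR_transpose, W.rowR_transpose, W.kernelRowR_transpose,
    W.PiR_transpose] at key
  exact key
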